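/- **Definitions.** For $x\in\mathbb R^p$, $\|x\|_0$ is the number of nonzero entries of $x$, $\|\cdot\|$ is the Euclidean norm, and $\mathbf e\in\mathbb R^m$ is the all-ones vector. A function $f:\mathbb N\to\mathbb R$ is in $p^{\Omega(1)}$ if there is $c>0$ with $f(p)\ge p^{c}$ for all sufficiently large $p$. A BPP algorithm is a randomized algorithm that runs in polynomial time; it *distinguishes* two cases if it accepts every input in the first case with probability at least $2/3$ and every input in the second case with probability at most $1/3$. A *two-prover MIP* for SAT consists of, for each input $\varphi$, finite sets $R,Q_1,Q_2,A_1,A_2$ with $R,A_1,A_2$ nonempty, questions $q_1:R\to Q_1$ and $q_2:R\to Q_2$, and a verdict $V:R\times A_1\times A_2\to\{0,1\}$, where the sizes of the sets, the questions and the verdict are computable in polynomial time. For strategies $P_i:Q_i\to A_i$ the acceptance probability is $\Pr_{r\in R}[V(r,P_1(q_1(r)),P_2(q_2(r)))=1]$ with $r$ uniform in $R$. It has *perfect completeness* if for every $\varphi\in\mathrm{SAT}$ some pair of strategies is accepted with probability $1$, and *soundness error at most $\epsilon$* if for every $\varphi\notin\mathrm{SAT}$ every pair of strategies is accepted with probability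 at most $\epsilon$. It satisfies *functionality* if for all $r,a_1$ there is at most one $a_2$ with $V(r,a_1,a_2)=1$, and *uniformity* if, for uniform $r$, $q_i(r)$ is uniformly distributed on $Q_i$ for $i=1,2$. **Biregular PGC.** There are $c>0$ and a polynomial bound $\mathrm{poly}(\cdot,\cdot)$ such that for every $\epsilon=\epsilon(N)>0$ with $\epsilon(N)\ge 1/N^{c}$ there is a two-prover MIP for SAT, satisfying functionality and uniformity, which on instances of size $N$ has perfect completeness, soundness error at most $\epsilon(N)$, and $|R|,|Q_1|,|Q_2|,|A_1|,|A_2|\le \mathrm{poly}(N,1/\epsilon(N))$. **Proposition.** Assume the Biregular PGC. Then there are $\sigma=\sigma(p)$ and $\Delta=\Delta(p)$, both in $p^{\Omega(1)}$, such that the following holds. If $\mathrm{SAT}\notin\mathrm{BPP}$, then there are a polynomial $m=m(p)$ and a positive integer $k=k(p)$, computable in time polynomial in $p$, such that no BPP algorithm, given a Boolean matrix $B$ of size $m(p)\times p$, distinguishes the following two cases, even if it only has to do so for all sufficiently large $p$: 1. there is $x\in\{0,1\}^p$ with $Bx=\mathbf e$ and $\|x\|_0\le k(p)$; 2. every $x\in\mathbb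 R^p$ with $\|Bx-\mathbf e\|^2\le\Delta(p)$ satisfies $\|x\|_0\ge k(p)\,\sigma(p)$. -/

import Mathlib

namespace SparseReg

/-! ## Machine model

Structured programs over registers that are stacks of bits.  Every elementary instruction inspects or
changes only the top of one stack and costs one step, so that a program is a multi-tape Turing machine
with structured control. -/

/-- Programs.  A program mentions finitely many of the registers `0, 1, 2, …`. -/
inductive Prog : Type where
  | skip : Prog
  | push (i : ℕ) (b : Bool) : Prog
  | pop (i : ℕ) : Prog
  | seq (P Q : Prog) : Prog
  /-- Three-way branch on register `i`: empty / top bit `false` / top bit `true`. -/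
  | branch (i : ℕ) (Pe Pf Pt : Prog) : Prog
  /-- Repeat the body as long as register `i` is nonempty. -/
  | loop (i : ℕ) (P : Prog) : Prog

/-- The contents of the registers; the head of a list is the top of the stack. -/
abbrev Regs : Type := ℕ → List Bool

/-- `Exec P s t s'`: program `P`, started with register contents `s`, halts after exactly `t` steps
with register contents `s'`. -/
inductive Exec : Prog → Regs → ℕ → Regs → Prop where
  | skip (s : Regs) : Exec Prog.skip s 1 s
  | push (i : ℕ) (b : Bool) (s : Regs) :
      Exec (Prog.push i b) s 1 (Function.update s i (b :: s i))
  | pop (i : ℕ) (s : Regs) :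
      Exec (Prog.pop i) s 1 (Function.update s i (s i).tail)
  | seq {P Q : Prog} {s s' s'' : Regs} {t t' : ℕ} :
      Exec P s t s' → Exec Q s' t' s'' → Exec (Prog.seq P Q) s (t + t') s''
  | branch_empty {i : ℕ} {Pe Pf Pt : Prog} {s s' : Regs} {t : ℕ} :
      s i = [] → Exec Pe s t s' → Exec (Prog.branch i Pe Pf Pt) s (t + 1) s'
  | branch_false {i : ℕ} {Pe Pf Pt : Prog} {s s' : Regs} {t : ℕ} :
      (s i).head? = some false → Exec Pf s t s' → Exec (Prog.branch i Pe Pf Pt) s (t + 1) s'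
  | branch_true {i : ℕ} {Pe Pf Pt : Prog} {s s' : Regs} {t : ℕ} :
      (s i).head? = some true → Exec Pt s t s' → Exec (Prog.branch i Pe Pf Pt) s (t + 1) s'
  | loop_done {i : ℕ} {P : Prog} {s : Regs} :
      s i = [] → Exec (Prog.loop i P) s 1 s
  | loop_step {i : ℕ} {P : Prog} {s s' s'' : Regs} {t t' : ℕ} :
      s i ≠ [] → Exec P s t s' → Exec (Prog.loop i P) s' t' s'' →
        Exec (Prog.loop i P) s (t + t' + 1) s''

/-- Initial registers: the inputs in registers `0, 1, …`, all others empty. -/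
def load (inputs : List (List Bool)) : Regs := fun i => inputs.getD i []

/-- A natural number in unary. -/
def unary (n : ℕ) : List Bool := List.replicate n true

/-- Total length of a list of inputs. -/
def inputSize (inputs : List (List Bool)) : ℕ := (inputs.map List.length).sum

/-- Some program computes, for every `a : α`, the string `out a` (in register `0`) from the strings
`inp a`, in time polynomial in the total length of `inp a`. -/
def PolyTime {α : Type} (inp : α → List (List Bool)) (out : α → List Bool) : Prop :=
  ∃ (P : Prog) (τ : Polynomial ℕ), ∀ a : α, ∃ (t : ℕ) (s : Regs),
    Exec P (load (inp a)) t s ∧ s 0 = out a ∧ t ≤ τ.eval (inputSize (inp a))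

/-! ## Bounded-error probabilistic polynomial time -/

/-- On input `x` and random string `w`, the program halts with the output `1`. -/
def Accepts (P : Prog) (x w : List Bool) : Prop :=
  ∃ (t : ℕ) (s : Regs), Exec P (load [x, w]) t s ∧ s 0 = [true]

open Classical in
/-- The probability that `P` accepts `x`, over a uniformly random string of `n` bits. -/
noncomputable def acceptProb (P : Prog) (n : ℕ) (x : List Bool) : ℝ :=
  ((Finset.univ.filter fun w : Fin n → Bool => Accepts P x (List.ofFn w)).card : ℝ) / 2 ^ n

/-- Some randomized algorithm distinguishes the inputs in `yes` from the inputs in `no`, with two-sided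
error at most `1/3`, using polynomially many random bits and polynomial time. -/
def BPPDistinguishable (yes no : Set (List Bool)) : Prop :=
  ∃ (P : Prog) (ρ τ : Polynomial ℕ),
    (∀ x ∈ yes ∪ no, ∀ w : Fin (ρ.eval x.length) → Bool, ∃ (t : ℕ) (s : Regs),
      Exec P (load [x, List.ofFn w]) t s ∧ t ≤ τ.eval x.length) ∧
    (∀ x ∈ yes, 2 / 3 ≤ acceptProb P (ρ.eval x.length) x) ∧
    (∀ x ∈ no, acceptProb P (ρ.eval x.length) x ≤ 1 / 3)

/-- The complexity class BPP. -/
def BPP : Set (Set (List Bool)) := {L | BPPDistinguishable L Lᶜ}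

/-! ## SAT -/

/-- A literal: a variable and its required truth value. -/
abbrev Literal : Type := ℕ × Bool

/-- A formula in conjunctive normal form, as a list of clauses. -/
abbrev CNF : Type := List (List Literal)

def CNF.Satisfiable (φ : CNF) : Prop :=
  ∃ v : ℕ → Bool, ∀ C ∈ φ, ∃ l ∈ C, v l.1 = l.2

/-- Self-delimiting binary encoding of a natural number. -/
def encodeNat (n : ℕ) : List Bool := (Nat.bits n).flatMap (fun b => [true, b]) ++ [false]

def encodeLiteral (l : Literal) : List Bool := encodeNat l.1 ++ [l.2]

def encodeClause (C : List Literal) : List Bool :=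
  C.flatMap (fun l => true :: encodeLiteral l) ++ [false]

def encodeCNF (φ : CNF) : List Bool :=
  φ.flatMap (fun C => true :: encodeClause C) ++ [false]

/-- The language SAT. The size of an instance is its length as a string. -/
def SAT : Set (List Bool) := {x | ∃ φ : CNF, encodeCNF φ = x ∧ CNF.Satisfiable φ}

/-! ## Two-prover one-round interactive proofs -/

/-- The verifier of a two-prover one-round proof system.  On input `x` the randomness, the questions
to and the answers of prover `i` range over finite sets `R`, `Qᵢ`, `Aᵢ`, listed as `0, 1, …`. -/
structure Verifier where
  nR : List Bool → ℕ
  nQ₁ : List Bool → ℕ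
  nQ₂ : List Bool → ℕ
  nA₁ : List Bool → ℕ
  nA₂ : List Bool → ℕ
  nR_pos : ∀ x, 0 < nR x
  nA₁_pos : ∀ x, 0 < nA₁ x
  nA₂_pos : ∀ x, 0 < nA₂ x
  query₁ : ∀ x, Fin (nR x) → Fin (nQ₁ x)
  query₂ : ∀ x, Fin (nR x) → Fin (nQ₂ x)
  accept : ∀ x, Fin (nR x) → Fin (nA₁ x) → Fin (nA₂ x) → Bool

namespace Verifier

/-- The verifier is a polynomial-time algorithm: it computes the sizes of its sets, its questions, and
its verdict. -/
def Efficient (V : Verifier) : Prop :=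
  PolyTime (fun x => [x]) (fun x => unary (V.nR x)) ∧
  PolyTime (fun x => [x]) (fun x => unary (V.nQ₁ x)) ∧
  PolyTime (fun x => [x]) (fun x => unary (V.nQ₂ x)) ∧
  PolyTime (fun x => [x]) (fun x => unary (V.nA₁ x)) ∧
  PolyTime (fun x => [x]) (fun x => unary (V.nA₂ x)) ∧
  PolyTime (α := (x : List Bool) × Fin (V.nR x))
    (fun a => [a.1, unary a.2]) (fun a => unary (V.query₁ a.1 a.2)) ∧
  PolyTime (α := (x : List Bool) × Fin (V.nR x))
    (fun a => [a.1, unary a.2]) (fun a => unary (V.query₂ a.1 a.2)) ∧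
  PolyTime (α := (x : List Bool) × Fin (V.nR x) × Fin (V.nA₁ x) × Fin (V.nA₂ x))
    (fun a => [a.1, unary a.2.1, unary a.2.2.1, unary a.2.2.2])
    (fun a => [V.accept a.1 a.2.1 a.2.2.1 a.2.2.2])

/-- The probability that the verifier accepts `x` when the provers use the strategies `P₁`, `P₂`. -/
noncomputable def value (V : Verifier) (x : List Bool)
    (P₁ : Fin (V.nQ₁ x) → Fin (V.nA₁ x)) (P₂ : Fin (V.nQ₂ x) → Fin (V.nA₂ x)) : ℝ :=
  ((Finset.univ.filter fun r : Fin (V.nR x) =>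
    V.accept x r (P₁ (V.query₁ x r)) (P₂ (V.query₂ x r)) = true).card : ℝ) / V.nR x

def PerfectCompleteness (V : Verifier) (L : Set (List Bool)) : Prop :=
  ∀ x ∈ L, ∃ P₁ P₂, V.value x P₁ P₂ = 1

/-- The soundness error on inputs of size `N` is at most `ε N`. -/
def SoundnessError (V : Verifier) (L : Set (List Bool)) (ε : ℕ → ℝ) : Prop :=
  ∀ x ∉ L, ∀ P₁ P₂, V.value x P₁ P₂ ≤ ε x.length

/-- All five sets have size at most `b N` on inputs of size `N`. -/
def SizeBound (V : Verifier) (b : ℕ → ℝ) : Prop :=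
  ∀ x, (V.nR x : ℝ) ≤ b x.length ∧ (V.nQ₁ x : ℝ) ≤ b x.length ∧ (V.nQ₂ x : ℝ) ≤ b x.length ∧
    (V.nA₁ x : ℝ) ≤ b x.length ∧ (V.nA₂ x : ℝ) ≤ b x.length

def Functionality (V : Verifier) : Prop :=
  ∀ x r a₁ a₂ a₂', V.accept x r a₁ a₂ = true → V.accept x r a₁ a₂' = true → a₂ = a₂'

/-- The question to each prover is uniformly distributed over the question set. -/
def Uniformity (V : Verifier) : Prop :=
  ∀ x,
    (∀ q, ((Finset.univ.filter fun r => V.query₁ x r = q).card : ℝ) / V.nR x = 1 / V.nQ₁ x) ∧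
    (∀ q, ((Finset.univ.filter fun r => V.query₂ x r = q).card : ℝ) / V.nR x = 1 / V.nQ₂ x)

end Verifier

/-- The Biregular Projection Games Conjecture.  The bound `(N + 1/ε)^d + d` is the general form of a
bound `poly(N, 1/ε)`. -/
def BiregularPGC : Prop :=
  ∃ c : ℝ, 0 < c ∧ ∃ d : ℕ, ∀ ε : ℕ → ℝ, (∀ N : ℕ, 0 < ε N ∧ 1 / (N : ℝ) ^ c ≤ ε N) →
    ∃ V : Verifier, V.Efficient ∧ V.PerfectCompleteness SAT ∧ V.SoundnessError SAT ε ∧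
      V.SizeBound (fun N => ((N : ℝ) + 1 / ε N) ^ d + d) ∧ V.Functionality ∧ V.Uniformity

/-! ## Sparse regression -/

/-- The class `p^{Ω(1)}`. -/
def PolyGrowth (f : ℕ → ℝ) : Prop :=
  ∃ c : ℝ, 0 < c ∧ ∀ᶠ p : ℕ in Filter.atTop, (p : ℝ) ^ c ≤ f p

/-- A Boolean matrix as a real 0/1 matrix. -/
def toReal {m p : ℕ} (B : Matrix (Fin m) (Fin p) Bool) : Matrix (Fin m) (Fin p) ℝ :=
  B.map fun b => if b then 1 else 0

/-- Encoding of a Boolean matrix: dimensions in unary, then the entries row by row. -/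
def encodeMatrix {m p : ℕ} (B : Matrix (Fin m) (Fin p) Bool) : List Bool :=
  unary m ++ [false] ++ unary p ++ [false] ++
    (List.ofFn fun i => List.ofFn fun j => B i j).flatten

/-- `B x = e` has a 0/1 solution with at most `k` nonzero entries. -/
def HasExactSparse {m p : ℕ} (B : Matrix (Fin m) (Fin p) Bool) (k : ℕ) : Prop :=
  ∃ x : Fin p → ℝ, (∀ j, x j = 0 ∨ x j = 1) ∧ (toReal B).mulVec x = 1 ∧ hammingNorm x ≤ k

/-- Every real `x` with `‖B x - e‖² ≤ Δ` (Euclidean norm) has at least `K` nonzero entries. -/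
def OnlyDense {m p : ℕ} (B : Matrix (Fin m) (Fin p) Bool) (Δ K : ℝ) : Prop :=
  ∀ x : Fin p → ℝ, ‖WithLp.toLp 2 ((toReal B).mulVec x - 1)‖ ^ 2 ≤ Δ → K ≤ (hammingNorm x : ℝ)

/-- Encoded `m(p) × p` matrices, `p ≥ p₀`, with an exact `k(p)`-sparse 0/1 solution. -/
def sparseCase (m : Polynomial ℕ) (k : ℕ → ℕ) (p₀ : ℕ) : Set (List Bool) :=
  {y | ∃ (p : ℕ) (B : Matrix (Fin (m.eval p)) (Fin p) Bool),
    p₀ ≤ p ∧ y = encodeMatrix B ∧ HasExactSparse B (k p)}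

/-- Encoded `m(p) × p` matrices, `p ≥ p₀`, all of whose `Δ(p)`-approximate solutions have at least
`k(p) σ(p)` nonzero entries. -/
def denseCase (m : Polynomial ℕ) (k : ℕ → ℕ) (σ Δ : ℕ → ℝ) (p₀ : ℕ) : Set (List Bool) :=
  {y | ∃ (p : ℕ) (B : Matrix (Fin (m.eval p)) (Fin p) Bool),
    p₀ ≤ p ∧ y = encodeMatrix B ∧ OnlyDense B (Δ p) (k p * σ p)}

end SparseReg

namespace SparseReg

/-! ## Execution of programs -/

/-! A SAT instance of length N, with a verifier of soundness error N^(-c), is turned into a linear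
system. Let H = (N+2)^g dominate the verifier's sets, and take p = H² columns. Each prover has H
copies of questions, copy u standing for question u mod |Qᵢ|. A column is a copy together with an
answer, and leftover columns are zero. Since both provers have H copies whatever |Q₁| and |Q₂| are,
the intended sparsity 2H depends on p alone. If u and v are copies of the questions asked under r,
and b is an answer, row (r, u, v, b) says that the weight at u of the answers accepted together with
b, plus the weight at v of all answers other than b, equals 1. Every other row, such as one with b =
|A₂|, says that the total weight at v is 1.

Completeness (`hasExactSparse_matrix`): the indicator of a pair of perfect strategies solves the
system. By functionality the first prover's answer is accepted with b exactly when b is the second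
prover's answer, so exactly one of the two parts of a row contributes.

Soundness: each row occurs at least p³ times among the p⁵ rows, so a total squared error of at most
p forces error at most 1/p in each row (`row_error`). If no accepted pair lay in the supports at u
and v, comparing row b with the normalization row would bound every weight at v by 2/p, and too few
answers are available for these to add up to about 1 (`exists_accepted`). Hence the supports form
lists of answers containing an accepted pair for every r. Averaging over blocks of copies, a
solution with at most K·H nonzero entries yields one list per question, with the average lengths of
the two provers' lists adding up to at most 2K. Popular answers and convexity turn these lists into
strategies of value at least 1/K² (`exists_value_ge`). With K = 3·p^(c/(8g)) this exceeds N^(-c) for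
large N.

Complexity: membership of a column in a row is decided by unary arithmetic and calls to the
verifier. The predicate `Clean` describes computations that preserve their inputs and leave no
debris; it is closed under composition, lazy branching and bounded loops, so the reduction is
assembled from such pieces. Its domain is an arbitrary type of instances, so promises can be carried
by subtypes. `BPPDistinguishable.of_reduction` then transfers a distinguisher to SAT, with short
instances answered from a table. -/

theorem Exec.det {P : Prog} {s s₁ s₂ : Regs} {t₁ t₂ : ℕ} (h₁ : Exec P s t₁ s₁)
    (h₂ : Exec P s t₂ s₂) : t₁ = t₂ ∧ s₁ = s₂ := by
  induction h₁ generalizing t₂ s₂ with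
  | skip s => cases h₂; exact ⟨rfl, rfl⟩
  | push i b s => cases h₂; exact ⟨rfl, rfl⟩
  | pop i s => cases h₂; exact ⟨rfl, rfl⟩
  | seq _ _ ih₁ ih₂ =>
    cases h₂ with
    | seq a b =>
      obtain ⟨rfl, rfl⟩ := ih₁ a
      obtain ⟨rfl, rfl⟩ := ih₂ b
      exact ⟨rfl, rfl⟩
  | branch_empty h _ ih =>
    cases h₂ with
    | branch_empty _ a => obtain ⟨rfl, rfl⟩ := ih a; exact ⟨rfl, rfl⟩
    | branch_false h' => simp [h] at h'
    | branch_true h' => simp [h] at h'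
  | branch_false h _ ih =>
    cases h₂ with
    | branch_empty h' => simp [h'] at h
    | branch_false _ a => obtain ⟨rfl, rfl⟩ := ih a; exact ⟨rfl, rfl⟩
    | branch_true h' => simp [h] at h'
  | branch_true h _ ih =>
    cases h₂ with
    | branch_empty h' => simp [h'] at h
    | branch_false h' => simp [h] at h'
    | branch_true _ a => obtain ⟨rfl, rfl⟩ := ih a; exact ⟨rfl, rfl⟩
  | loop_done h =>
    cases h₂ with
    | loop_done => exact ⟨rfl, rfl⟩
    | loop_step h' => exact absurd h h'
  | loop_step h _ _ ih₁ ih₂ =>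
    cases h₂ with
    | loop_done h' => exact absurd h' h
    | loop_step _ a b =>
      obtain ⟨rfl, rfl⟩ := ih₁ a
      obtain ⟨rfl, rfl⟩ := ih₂ b
      exact ⟨rfl, rfl⟩

/-- Renaming of registers. -/
def Prog.rename (ρ : ℕ → ℕ) : Prog → Prog
  | .skip => .skip
  | .push i b => .push (ρ i) b
  | .pop i => .pop (ρ i)
  | .seq P Q => .seq (P.rename ρ) (Q.rename ρ)
  | .branch i P Q R => .branch (ρ i) (P.rename ρ) (Q.rename ρ) (R.rename ρ)
  | .loop i P => .loop (ρ i) (P.rename ρ)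

/-- A strict upper bound on the registers mentioned by a program. -/
def Prog.bound : Prog → ℕ
  | .skip => 0
  | .push i _ => i + 1
  | .pop i => i + 1
  | .seq P Q => max P.bound Q.bound
  | .branch i P Q R => max (i + 1) (max P.bound (max Q.bound R.bound))
  | .loop i P => max (i + 1) P.bound

/-- A step pushes at most one bit. This bounds outputs by running times, which keeps intermediate
results polynomial under composition. -/
theorem Exec.length_le {P : Prog} {s s' : Regs} {t : ℕ} (h : Exec P s t s') (i : ℕ) :
    (s' i).length ≤ (s i).length + t := by
  induction h with
  | skip s => omega
  | push j b s =>
    by_cases e : i = j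
    · subst e; simp
    · simp [Function.update_of_ne e]
  | pop j s =>
    by_cases e : i = j
    · subst e; simp; omega
    · simp [Function.update_of_ne e]
  | seq _ _ ih₁ ih₂ => omega
  | branch_empty _ _ ih => omega
  | branch_false _ _ ih => omega
  | branch_true _ _ ih => omega
  | loop_done _ => omega
  | loop_step _ _ _ ih₁ ih₂ => omega

/-- A program run on a renamed copy of its registers leaves the other registers alone. -/
theorem Exec.rename {P : Prog} {s s' : Regs} {t : ℕ} (h : Exec P s t s') {k : ℕ}
    (hk : P.bound ≤ k) {ρ : ℕ → ℕ} (hρ : ∀ i j, i < k → j < k → ρ i = ρ j → i = j)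
    {S : Regs} (hS : ∀ i < k, S (ρ i) = s i) :
    ∃ S', Exec (P.rename ρ) S t S' ∧ (∀ i < k, S' (ρ i) = s' i) ∧
      ∀ j, (∀ i < k, ρ i ≠ j) → S' j = S j := by
  induction h generalizing S with
  | skip s => exact ⟨S, .skip S, hS, fun _ _ => rfl⟩
  | push i b s =>
    simp only [Prog.bound] at hk
    refine ⟨_, .push _ _ _, fun j hj => ?_, fun j hj => ?_⟩
    · by_cases e : j = i
      · subst e; simp [hS j hj]
      · have : ρ j ≠ ρ i := fun h => e (hρ _ _ hj (by omega) h)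
        simp [Function.update_of_ne this, Function.update_of_ne e, hS j hj]
    · exact Function.update_of_ne (hj i (by omega)).symm _ _
  | pop i s =>
    simp only [Prog.bound] at hk
    refine ⟨_, .pop _ _, fun j hj => ?_, fun j hj => ?_⟩
    · by_cases e : j = i
      · subst e; simp [hS j hj]
      · have : ρ j ≠ ρ i := fun h => e (hρ _ _ hj (by omega) h)
        simp [Function.update_of_ne this, Function.update_of_ne e, hS j hj]
    · exact Function.update_of_ne (hj i (by omega)).symm _ _
  | seq _ _ ih₁ ih₂ =>
    simp only [Prog.bound, max_le_iff] at hk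
    obtain ⟨S₁, e₁, h₁, f₁⟩ := ih₁ hk.1 hS
    obtain ⟨S₂, e₂, h₂, f₂⟩ := ih₂ hk.2 h₁
    exact ⟨S₂, .seq e₁ e₂, h₂, fun j hj => (f₂ j hj).trans (f₁ j hj)⟩
  | branch_empty h _ ih =>
    simp only [Prog.bound, max_le_iff] at hk
    obtain ⟨S₁, e₁, h₁, f₁⟩ := ih hk.2.1 hS
    exact ⟨S₁, .branch_empty (by rw [hS _ (by omega), h]) e₁, h₁, f₁⟩
  | branch_false h _ ih =>
    simp only [Prog.bound, max_le_iff] at hk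
    obtain ⟨S₁, e₁, h₁, f₁⟩ := ih hk.2.2.1 hS
    exact ⟨S₁, .branch_false (by rw [hS _ (by omega), h]) e₁, h₁, f₁⟩
  | branch_true h _ ih =>
    simp only [Prog.bound, max_le_iff] at hk
    obtain ⟨S₁, e₁, h₁, f₁⟩ := ih hk.2.2.2 hS
    exact ⟨S₁, .branch_true (by rw [hS _ (by omega), h]) e₁, h₁, f₁⟩
  | loop_done h =>
    simp only [Prog.bound, max_le_iff] at hk
    exact ⟨S, .loop_done (by rw [hS _ (by omega), h]), hS, fun _ _ => rfl⟩
  | loop_step h _ _ ih₁ ih₂ =>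
    have hk' := hk
    simp only [Prog.bound, max_le_iff] at hk
    obtain ⟨S₁, e₁, h₁, f₁⟩ := ih₁ hk.2 hS
    obtain ⟨S₂, e₂, h₂, f₂⟩ := ih₂ hk' h₁
    exact ⟨S₂, .loop_step (by rw [hS _ (by omega)]; exact h) e₁ e₂, h₂,
      fun j hj => (f₂ j hj).trans (f₁ j hj)⟩

theorem Prog.rename_id (P : Prog) : P.rename id = P := by
  induction P <;> simp_all [Prog.rename]

/-- Registers beyond the bound of a program neither change nor matter. -/
theorem Exec.frame {P : Prog} {s s' : Regs} {t : ℕ} (h : Exec P s t s') {k : ℕ}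
    (hk : P.bound ≤ k) {S : Regs} (hS : ∀ i < k, S i = s i) :
    ∃ S', Exec P S t S' ∧ (∀ i < k, S' i = s' i) ∧ ∀ j, k ≤ j → S' j = S j := by
  obtain ⟨S', e, h₁, h₂⟩ := h.rename hk (ρ := id) (fun _ _ _ _ h => h) hS
  rw [Prog.rename_id] at e
  exact ⟨S', e, h₁, fun j hj => h₂ j fun i hi => by simp; omega⟩

theorem Exec.eq_of_bound_le {P : Prog} {s s' : Regs} {t : ℕ} (h : Exec P s t s') {j : ℕ}
    (hj : P.bound ≤ j) : s' j = s j := by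
  obtain ⟨S', e, -, h₂⟩ := h.frame le_rfl (S := s) fun _ _ => rfl
  rw [(h.det e).2, h₂ j hj]

/-! ## Basic programs -/

/-- Started from `s`, the program reaches `s'` within `T` steps. -/
def Runs (P : Prog) (s s' : Regs) (T : ℕ) : Prop := ∃ t ≤ T, Exec P s t s'

theorem Runs.seq {P Q : Prog} {s s' s'' : Regs} {T T' : ℕ} (h : Runs P s s' T)
    (h' : Runs Q s' s'' T') : Runs (.seq P Q) s s'' (T + T') := by
  obtain ⟨t, ht, e⟩ := h
  obtain ⟨t', ht', e'⟩ := h'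
  exact ⟨_, by omega, .seq e e'⟩

theorem Runs.mono {P : Prog} {s s' : Regs} {T T' : ℕ} (h : Runs P s s' T) (hT : T ≤ T') :
    Runs P s s' T' := by
  obtain ⟨t, ht, e⟩ := h
  exact ⟨t, ht.trans hT, e⟩

theorem Runs.congr {P : Prog} {s s' s'' : Regs} {T T' : ℕ} (h : Runs P s s' T) (hT : T ≤ T')
    (hs : ∀ i, s'' i = s' i) : Runs P s s'' T' := by
  rw [funext hs]
  exact h.mono hT

theorem Exec.congr {P : Prog} {s s' s'' : Regs} {t : ℕ} (h : Exec P s t s')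
    (hs : ∀ i, s'' i = s' i) : Exec P s t s'' := by
  rwa [funext hs]

theorem Runs.push (i : ℕ) (b : Bool) (s : Regs) :
    Runs (.push i b) s (Function.update s i (b :: s i)) 1 := ⟨1, le_rfl, .push i b s⟩

theorem Runs.pop (i : ℕ) (s : Regs) :
    Runs (.pop i) s (Function.update s i (s i).tail) 1 := ⟨1, le_rfl, .pop i s⟩

/-- Empty a register. -/
def clear (i : ℕ) : Prog := .loop i (.pop i)

theorem runs_clear (i : ℕ) (s : Regs) :
    Runs (clear i) s (Function.update s i []) (2 * (s i).length + 1) := by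
  obtain ⟨l, hl⟩ : ∃ l, s i = l := ⟨_, rfl⟩
  induction l generalizing s with
  | nil =>
    refine ⟨1, by omega, ?_⟩
    rw [← hl, Function.update_eq_self]
    exact .loop_done hl
  | cons b l ih =>
    obtain ⟨t, ht, e⟩ := ih (Function.update s i (s i).tail) (by simp [hl])
    refine ⟨1 + t + 1, ?_, .loop_step (by simp [hl]) (.pop i s) (by simpa [clear] using e)⟩
    simp [hl] at ht ⊢
    omega

/-- Empty the registers `a, …, a + k - 1`. -/
def clearFrom (a : ℕ) : ℕ → Prog
  | 0 => .skip
  | k + 1 => .seq (clearFrom a k) (clear (a + k))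

theorem runs_clearFrom (a k : ℕ) (s : Regs) (L : ℕ) (hL : ∀ i, (s i).length ≤ L) :
    Runs (clearFrom a k) s (fun i => if a ≤ i ∧ i < a + k then [] else s i)
      (k * (2 * L + 1) + 1) := by
  induction k with
  | zero =>
    refine ⟨1, by omega, ?_⟩
    refine (Exec.skip s).congr fun i => ?_
    rw [if_neg (by omega)]
  | succ k ih =>
    refine (ih.seq (runs_clear (a + k) _)).congr ?_ fun i => ?_
    · have := hL (a + k)
      simp
      linarith
    · by_cases e : i = a + k
      · subst e; simp
      · rw [Function.update_of_ne e]
        congr 1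
        simp
        omega

/-- Move register `i` on top of register `j`, reversed. -/
def moveRev (i j : ℕ) : Prog :=
  .loop i (.branch i .skip (.seq (.pop i) (.push j false)) (.seq (.pop i) (.push j true)))

theorem runs_moveRev {i j : ℕ} (hij : i ≠ j) (s : Regs) :
    Runs (moveRev i j) s (Function.update (Function.update s j ((s i).reverse ++ s j)) i [])
      (4 * (s i).length + 1) := by
  obtain ⟨l, hl⟩ : ∃ l, s i = l := ⟨_, rfl⟩
  induction l generalizing s with
  | nil =>
    refine ⟨1, by omega, ?_⟩
    refine (Exec.loop_done hl).congr fun k => ?_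
    by_cases hk : k = i
    · subst hk; simp [hl]
    · by_cases hk' : k = j
      · subst hk'; simp [hl, hk]
      · simp [hk, hk']
  | cons b l ih =>
    set s₁ := Function.update (Function.update s i (s i).tail) j
      (b :: Function.update s i (s i).tail j) with hs₁
    have hstep : Exec (.branch i .skip (.seq (.pop i) (.push j false))
        (.seq (.pop i) (.push j true))) s 3 s₁ := by
      cases b
      · exact .branch_false (by simp [hl]) (.seq (.pop i s) (.push j false _))
      · exact .branch_true (by simp [hl]) (.seq (.pop i s) (.push j true _))
    have hs₁i : s₁ i = l := by simp [hs₁, hij, hl]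
    have hs₁j : s₁ j = b :: s j := by simp [hs₁, hij.symm]
    obtain ⟨t, ht, e⟩ := ih s₁ hs₁i
    refine ⟨3 + t + 1, ?_, .loop_step (by simp [hl]) hstep ?_⟩
    · simp [hl, hs₁i] at ht ⊢
      omega
    · refine e.congr fun k => ?_
      by_cases hk : k = i
      · subst hk; simp
      · by_cases hk' : k = j
        · subst hk'; simp [hk, hs₁i, hs₁j, hl]
        · simp [hk, hk', hs₁]

/-- Move register `i` on top of register `j`, using the empty register `k`. -/
def move (i j k : ℕ) : Prog := .seq (moveRev i k) (moveRev k j)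

theorem runs_move {i j k : ℕ} (hij : i ≠ j) (hik : i ≠ k) (hjk : j ≠ k) (s : Regs)
    (hk : s k = []) :
    Runs (move i j k) s (Function.update (Function.update s j (s i ++ s j)) i [])
      (8 * (s i).length + 2) := by
  have h := (runs_moveRev hik s).seq (runs_moveRev hjk.symm _)
  refine h.congr ?_ fun l => ?_
  · simp [hik.symm, hk]; omega
  · by_cases h1 : l = i
    · subst h1; simp [hij, hik]
    · by_cases h2 : l = j
      · subst h2; simp [h1, hik.symm, hjk, hk]
      · by_cases h3 : l = k
        · subst h3; simp [h1, h2, hk]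
        · simp [h1, h2, h3]

/-- Unload register `k`, reversed, on both registers `i` and `j`. -/
def moveRevTwo (k i j : ℕ) : Prog :=
  .loop k (.branch k .skip
    (.seq (.pop k) (.seq (.push i false) (.push j false)))
    (.seq (.pop k) (.seq (.push i true) (.push j true))))

theorem runs_moveRevTwo {k i j : ℕ} (hij : i ≠ j) (hik : i ≠ k) (hjk : j ≠ k) (s : Regs) :
    Runs (moveRevTwo k i j) s
      (Function.update (Function.update (Function.update s i ((s k).reverse ++ s i)) j
        ((s k).reverse ++ s j)) k []) (5 * (s k).length + 1) := by
  obtain ⟨l, hl⟩ : ∃ l, s k = l := ⟨_, rfl⟩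
  induction l generalizing s with
  | nil =>
    refine ⟨1, by omega, ?_⟩
    refine (Exec.loop_done hl).congr fun m => ?_
    by_cases h1 : m = k
    · subst h1; simp [hl]
    · by_cases h2 : m = i
      · subst h2; simp [hl, h1]
      · by_cases h3 : m = j
        · subst h3; simp [hl, h1]
        · simp [h1, h2, h3]
  | cons b l ih =>
    set s₁ := Function.update (Function.update (Function.update s k l) i (b :: s i)) j
      (b :: s j) with hs₁
    have hseq : ∀ c, Exec (.seq (.pop k) (.seq (.push i c) (.push j c))) s 3
        (Function.update (Function.update (Function.update s k l) i (c :: s i)) j (c :: s j)) := by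
      intro c
      have := Exec.seq (Exec.pop k s) (Exec.seq (Exec.push i c _) (Exec.push j c _))
      simpa [hl, hik, hjk, hij.symm] using this
    have hstep : Exec (.branch k .skip
        (.seq (.pop k) (.seq (.push i false) (.push j false)))
        (.seq (.pop k) (.seq (.push i true) (.push j true)))) s 4 s₁ := by
      cases b
      · exact .branch_false (by simp [hl]) (hseq false)
      · exact .branch_true (by simp [hl]) (hseq true)
    have hk : s₁ k = l := by simp [hs₁, hik.symm, hjk.symm]
    have hi : s₁ i = b :: s i := by simp [hs₁, hij]
    have hj : s₁ j = b :: s j := by simp [hs₁]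
    obtain ⟨t, ht, e⟩ := ih s₁ hk
    refine ⟨4 + t + 1, ?_, .loop_step (by simp [hl]) hstep ?_⟩
    · simp [hl, hk] at ht ⊢
      omega
    · refine e.congr fun m => ?_
      by_cases h1 : m = k
      · subst h1; simp
      · by_cases h2 : m = i
        · subst h2; simp [h1, hij, hk, hi, hl]
        · by_cases h3 : m = j
          · subst h3; simp [h1, hk, hj, hl]
          · simp [h1, h2, h3, hs₁]

/-- Copy register `i` on top of register `j`, using the empty register `k`. -/
def copy (i j k : ℕ) : Prog := .seq (moveRev i k) (moveRevTwo k i j)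

theorem runs_copy {i j k : ℕ} (hij : i ≠ j) (hik : i ≠ k) (hjk : j ≠ k) (s : Regs)
    (hk : s k = []) :
    Runs (copy i j k) s (Function.update s j (s i ++ s j)) (9 * (s i).length + 2) := by
  have h := (runs_moveRev hik s).seq (runs_moveRevTwo hij hik hjk _)
  refine h.congr ?_ fun l => ?_
  · simp [hik.symm, hk]; omega
  · by_cases h1 : l = i
    · subst h1; simp [hij, hik, hik.symm, hk]
    · by_cases h2 : l = j
      · subst h2; simp [h1, hik.symm, hjk, hk]
      · by_cases h3 : l = k
        · subst h3; simp [h2, hk]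
        · simp [h1, h2, h3]

section

/-! ## Polynomial-time functions of a list of registers -/

theorem eval_mono (τ : Polynomial ℕ) {a b : ℕ} (h : a ≤ b) : τ.eval a ≤ τ.eval b := by
  rw [Polynomial.eval_eq_sum, Polynomial.eval_eq_sum]
  exact Finset.sum_le_sum fun i _ => Nat.mul_le_mul_left _ (Nat.pow_le_pow_left h i)

theorem load_apply (l : List (List Bool)) (i : ℕ) : load l i = l.getD i [] := rfl

theorem load_of_le {l : List (List Bool)} {i : ℕ} (h : l.length ≤ i) : load l i = [] := by
  simp [load_apply, h]

theorem load_append_left {l : List (List Bool)} (x : List (List Bool)) {i : ℕ}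
    (h : i < l.length) : load (l ++ x) i = load l i := by
  simp [load_apply, List.getElem?_append_left h]

theorem load_append_length (l : List (List Bool)) (x : List Bool) {n : ℕ} (h : l.length = n) :
    load (l ++ [x]) n = x := by
  subst h; simp [load_apply]

theorem load_append_nil (l : List (List Bool)) : load (l ++ [[]]) = load l := by
  ext1 i
  rcases lt_trichotomy i l.length with h | h | h
  · rw [load_append_left _ h]
  · rw [load_append_length _ _ h.symm, load_of_le h.ge]
  · rw [load_of_le (by simp; omega), load_of_le h.le]

theorem load_append_singleton (l : List (List Bool)) (x : List Bool) {n : ℕ} (h : l.length = n) :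
    load (l ++ [x]) = Function.update (load l) n x := by
  ext1 i
  rcases lt_trichotomy i n with h' | h' | h'
  · rw [load_append_left _ (by omega), Function.update_of_ne h'.ne]
  · subst h'; rw [load_append_length _ _ h, Function.update_self]
  · rw [load_of_le (by simp; omega), Function.update_of_ne h'.ne', load_of_le (by omega)]

theorem length_load_le (l : List (List Bool)) (i : ℕ) : (load l i).length ≤ inputSize l := by
  rw [load_apply]
  induction l generalizing i with
  | nil => simp
  | cons x l ih =>
    cases i with
    | zero => simp [inputSize]
    | succ i =>
      have := ih i
      simp [inputSize] at this ⊢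
      omega

theorem inputSize_append (l l' : List (List Bool)) :
    inputSize (l ++ l') = inputSize l + inputSize l' := by
  simp [inputSize]

theorem inputSize_singleton (x : List Bool) : inputSize [x] = x.length := by
  simp [inputSize]

theorem length_unary (n : ℕ) : (unary n).length = n := by simp [unary]

variable {α β : Type} {n : ℕ} {inp : α → List (List Bool)}

/-- Some polynomial-time program appends `out a` to the `n` registers `inp a`, leaving these
unchanged and all others empty. -/
def Clean (n : ℕ) (inp : α → List (List Bool)) (out : α → List Bool) : Prop :=
  (∀ a, (inp a).length = n) ∧ ∃ (P : Prog) (τ : Polynomial ℕ), ∀ a,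
    Runs P (load (inp a)) (load (inp a ++ [out a])) (τ.eval (inputSize (inp a)))

theorem PolyTime.comap {out : α → List Bool} (h : PolyTime inp out) (e : β → α) :
    PolyTime (fun b => inp (e b)) (fun b => out (e b)) := by
  obtain ⟨P, τ, h⟩ := h
  exact ⟨P, τ, fun b => h (e b)⟩

theorem Clean.comap {out : α → List Bool} (h : Clean n inp out) (e : β → α) :
    Clean n (fun b => inp (e b)) (fun b => out (e b)) := by
  obtain ⟨hn, P, τ, h⟩ := h
  exact ⟨fun b => hn _, P, τ, fun b => h (e b)⟩

/-- The output register lies just beyond the inputs and starts empty, so everything in it was pushed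
during the run. -/
theorem Runs.length_le {l : List (List Bool)} {x : List Bool} {P : Prog} {T : ℕ}
    (h : Runs P (load l) (load (l ++ [x])) T) : x.length ≤ T := by
  obtain ⟨t, ht, e⟩ := h
  have := e.length_le l.length
  rw [load_append_length _ _ rfl, load_of_le le_rfl] at this
  simp at this
  omega

theorem Clean.polyTime {out : α → List Bool} (h : Clean n inp out) : PolyTime inp out := by
  obtain ⟨hn, P, τ, h⟩ := h
  -- Without inputs the output is already in register 0. Otherwise the first input has to make room
  -- for it.
  rcases Nat.eq_zero_or_pos n with rfl | hpos
  · refine ⟨P, τ, fun a => ?_⟩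
    obtain ⟨t, ht, e⟩ := h a
    exact ⟨t, _, e, load_append_length _ _ (hn a), ht⟩
  · refine ⟨.seq P (.seq (clear 0) (move n 0 (n + 1))),
      τ + (2 * Polynomial.X + 1 + (8 * τ + 2)), fun a => ?_⟩
    have h0 := length_load_le (inp a) 0
    have hl := (h a).length_le
    have := (h a).seq ((runs_clear 0 _).seq (runs_move (i := n) (j := 0) (k := n + 1) (by omega)
      (by omega) (by omega) _ (by
        rw [Function.update_of_ne (by omega), load_of_le (by simp [hn])])))
    obtain ⟨t, ht, e⟩ := this
    refine ⟨t, _, e, ?_, ht.trans ?_⟩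
    · simp [hpos.ne, hpos.ne', load_append_length _ _ (hn a)]
    · rw [Function.update_of_ne (by omega), load_append_length _ _ (hn a),
        load_append_left _ (by rw [hn]; omega)]
      simp
      omega

/-- Copy the registers in the list to the registers from `b` on, using the empty register `n`. -/
def copyAll (n : ℕ) : List ℕ → ℕ → Prog
  | [], _ => .skip
  | i :: l, b => .seq (copy i b n) (copyAll n l (b + 1))

theorem runs_copyAll {n : ℕ} {L : ℕ} (idx : List ℕ) (hidx : ∀ i ∈ idx, i < n) (b : ℕ) (hb : n < b)
    (s : Regs) (hs : s n = []) (hsb : ∀ j, b ≤ j → s j = []) (hL : ∀ i, i < n → (s i).length ≤ L) :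
    Runs (copyAll n idx b) s (fun j => if b ≤ j then (idx.map s).getD (j - b) [] else s j)
      (idx.length * (9 * L + 2) + 1) := by
  induction idx generalizing b s with
  | nil =>
    refine ⟨1, by omega, (Exec.skip s).congr fun j => ?_⟩
    split_ifs with h
    · simp [hsb j h]
    · rfl
  | cons i l ih =>
    have hi := hidx i (by simp)
    have h1 := runs_copy (i := i) (j := b) (k := n) (by omega) (by omega) (by omega) s hs
    set s₁ := Function.update s b (s i ++ s b) with hs₁
    have hne : ∀ j, j ≠ b → s₁ j = s j := fun j hj => Function.update_of_ne hj _ _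
    have h2 := ih (fun j hj => hidx j (by simp [hj])) (b + 1) (by omega) s₁
      (by rw [hne _ (by omega), hs]) (fun j hj => by rw [hne _ (by omega), hsb _ (by omega)])
      (fun j hj => by rw [hne _ (by omega)]; exact hL j hj)
    refine (h1.seq h2).congr ?_ fun j => ?_
    · have := hL i hi
      simp
      linarith
    · have hmap : l.map s₁ = l.map s :=
        List.map_congr_left fun j hj => hne j (by have := hidx j (by simp [hj]); omega)
      rw [hmap]
      rcases lt_trichotomy j b with h | h | h
      · rw [if_neg (by omega), if_neg (by omega), hne j (by omega)]
      · subst h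
        simp [hs₁, hsb j le_rfl]
      · rw [if_pos (by omega), if_pos (by omega)]
        obtain ⟨d, rfl⟩ : ∃ d, j = b + 1 + d := ⟨j - (b + 1), by omega⟩
        rw [show b + 1 + d - b = d + 1 by omega, show b + 1 + d - (b + 1) = d by omega]
        simp

/-- A polynomial-time program can be called on a selection of the registers. -/
theorem PolyTime.reindex {out : α → List Bool} (hn : ∀ a, (inp a).length = n) (idx : List ℕ)
    (hidx : ∀ i ∈ idx, i < n) (h : PolyTime (fun a => idx.map (load (inp a))) out) :
    Clean n inp out := by
  obtain ⟨P, τ, h⟩ := h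
  -- The relocated window must cover both the registers the program mentions and all the copied
  -- inputs, so that clearing it removes every trace of the call.
  set k := max P.bound idx.length with hk
  -- Indices may be repeated, so the copied input can be `idx.length` times as large as the
  -- original.
  let τ' : Polynomial ℕ := τ.comp (Polynomial.C idx.length * Polynomial.X)
  refine ⟨hn, .seq (copyAll n idx (n + 1)) (.seq (P.rename (· + (n + 1)))
    (.seq (clearFrom (n + 2) k) (move (n + 1) n (n + 2)))),
    Polynomial.C idx.length * (9 * Polynomial.X + 2) + 1 + (τ' + (Polynomial.C k *
      (2 * (Polynomial.X + τ') + 1) + 1 + (8 * (Polynomial.X + τ') + 2))), fun a => ?_⟩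
  obtain ⟨t, s, e, hs, ht⟩ := h a
  beta_reduce at e ht
  set N := inputSize (inp a) with hN
  have h1 := runs_copyAll (n := n) (L := N) idx hidx (n + 1) (by omega) (load (inp a))
    (load_of_le (hn a).le) (fun j hj => load_of_le (by rw [hn]; omega))
    (fun i _ => length_load_le _ _)
  set S₁ : Regs := fun j => if n + 1 ≤ j then (idx.map (load (inp a))).getD (j - (n + 1)) []
    else load (inp a) j with hS₁
  have hS₁hi : ∀ d, S₁ (d + (n + 1)) = load (idx.map (load (inp a))) d := fun d => by
    simp only [hS₁]
    rw [if_pos (by omega), Nat.add_sub_cancel, load_apply]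
  have hS₁lo : ∀ j, j ≤ n → S₁ j = load (inp a) j := fun j hj => by
    simp only [hS₁]
    rw [if_neg (by omega)]
  obtain ⟨S₂, e₂, h₂, f₂⟩ := e.rename (k := k) (le_max_left _ _) (ρ := (· + (n + 1)))
    (fun _ _ _ _ h => by simpa using h) (S := S₁) (fun i _ => hS₁hi i)
  have ht' : t ≤ τ'.eval N := by
    refine ht.trans ?_
    simp only [τ', Polynomial.eval_comp, Polynomial.eval_mul, Polynomial.eval_C,
      Polynomial.eval_X]
    refine eval_mono τ ?_
    clear * -
    induction idx with
    | nil => simp [inputSize]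
    | cons i l ih =>
      have := length_load_le (inp a) i
      simp only [inputSize, List.map_cons, List.sum_cons, List.length_cons] at ih ⊢
      rw [Nat.succ_mul]
      omega
  have hS₂low : ∀ j, j ≤ n → S₂ j = load (inp a) j := fun j hj => by
    rw [f₂ j (fun i _ => by simp; omega), hS₁lo j hj]
  have hS₂high : ∀ j, n + 1 + k ≤ j → S₂ j = [] := fun j hj => by
    have := le_max_right P.bound idx.length
    obtain ⟨d, rfl⟩ : ∃ d, j = d + (n + 1) := ⟨j - (n + 1), by omega⟩
    rw [f₂ _ (fun i hi => by simp; omega), hS₁hi, load_of_le (by simp; omega)]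
  have hL : ∀ j, (S₂ j).length ≤ N + τ'.eval N := fun j => by
    rcases Nat.lt_or_ge n j with hj | hj
    · obtain ⟨d, rfl⟩ : ∃ d, j = d + (n + 1) := ⟨j - (n + 1), by omega⟩
      have hd : (load (idx.map (load (inp a))) d).length ≤ N := by
        by_cases hd : d < idx.length
        · rw [load_apply, List.getD_eq_getElem _ _ (by simpa using hd), List.getElem_map]
          exact length_load_le _ _
        · rw [load_of_le (by simpa using hd)]; simp
      by_cases hj' : k ≤ d
      · simp [hS₂high (d + (n + 1)) (by omega)]
      · have := e.length_le d
        rw [h₂ d (by omega)]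
        omega
    · rw [hS₂low j hj]
      exact (length_load_le _ _).trans (by omega)
  have h3 := runs_clearFrom (n + 2) k S₂ _ hL
  set S₃ : Regs := fun i => if n + 2 ≤ i ∧ i < n + 2 + k then [] else S₂ i with hS₃
  have hS₃' : ∀ j, n + 2 ≤ j → S₃ j = [] := fun j hj => by
    by_cases hj' : j < n + 2 + k
    · simp [hS₃, hj, hj']
    · simp [hS₃, hj', hS₂high j (by omega)]
  have hS₃n : S₃ n = [] := by simp [hS₃, hS₂low n le_rfl, load_of_le (hn a).le]
  have hS₃o : S₃ (n + 1) = out a := by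
    rw [← hs]
    -- For k = 0 the program mentions no register and receives no input, so its output is empty.
    by_cases hk0 : 0 < k
    · have := h₂ 0 hk0
      simpa [hS₃] using this
    · have h0 : k = 0 := by omega
      have : S₃ (n + 1) = [] := by simp [hS₃, hS₂high (n + 1) (by omega)]
      have hb := le_max_left P.bound idx.length
      have hb' := le_max_right P.bound idx.length
      rw [this, e.eq_of_bound_le (by omega), load_of_le (by rw [List.length_map]; omega)]
  have h4 := runs_move (i := n + 1) (j := n) (k := n + 2) (by omega) (by omega) (by omega) S₃
    (hS₃' _ le_rfl)
  have hlen : (out a).length ≤ N + τ'.eval N := by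
    have := hL (n + 1)
    rw [← hS₃o]
    simpa [hS₃] using this
  refine (h1.seq (Runs.seq ⟨t, le_rfl, e₂⟩ (h3.seq h4))).congr ?_ fun j => ?_
  · rw [hS₃o]
    simp only [Polynomial.eval_add, Polynomial.eval_mul, Polynomial.eval_C, Polynomial.eval_X,
      Polynomial.eval_one, Polynomial.eval_ofNat]
    gcongr
  · rcases lt_trichotomy j n with hj | hj | hj
    · rw [load_append_left _ (by rw [hn]; exact hj), Function.update_of_ne (by omega),
        Function.update_of_ne (by omega)]
      simp [hS₃, hS₂low j hj.le]; omega
    · subst hj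
      rw [load_append_length _ _ (hn a)]
      simp [hS₃n, hS₃o]
    · rw [load_of_le (by simp [hn]; omega)]
      by_cases hj' : j = n + 1
      · subst hj'; simp
      · rw [Function.update_of_ne hj', Function.update_of_ne (by omega), hS₃' _ (by omega)]

/-! ### Composition of computations -/

theorem Clean.lift {out : α → List Bool} (h : Clean n inp out) {k : ℕ}
    {inp' : α → List (List Bool)} (hk : ∀ a, (inp' a).length = k) :
    Clean (n + k) (fun a => inp a ++ inp' a) out := by
  refine PolyTime.reindex (fun a => by simp [h.1, hk]) (List.range n)
    (fun i hi => by simp at hi; omega) ?_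
  convert h.polyTime using 2 with a
  refine List.ext_getElem (by simp [h.1]) fun i h1 h2 => ?_
  rw [List.getElem_map, List.getElem_range, load_append_left _ h2, load_apply,
    List.getD_eq_getElem _ _ h2]

/-- The intermediate value occupies register n while g is computed; it is then erased and the result
takes its place. The cost stays polynomial because the intermediate value is no longer than the time
spent on it. -/
theorem Clean.letIn {f g : α → List Bool} (hf : Clean n inp f)
    (hg : Clean (n + 1) (fun a => inp a ++ [f a]) g) : Clean n inp g := by
  obtain ⟨hn, P, τ, hf⟩ := hf
  obtain ⟨-, Q, τ', hg⟩ := hg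
  let τ₂ := τ'.comp (Polynomial.X + τ)
  refine ⟨hn, .seq P (.seq Q (.seq (clear n) (move (n + 1) n (n + 2)))),
    τ + (τ₂ + (2 * τ + 1 + (8 * τ₂ + 2))), fun a => ?_⟩
  have hfl := (hf a).length_le
  have hQ : Runs Q (load (inp a ++ [f a])) (load (inp a ++ [f a] ++ [g a]))
      (τ₂.eval (inputSize (inp a))) := by
    refine (hg a).mono ?_
    simp only [τ₂, Polynomial.eval_comp, inputSize_append, inputSize_singleton,
      Polynomial.eval_add, Polynomial.eval_X]
    exact eval_mono _ (by omega)
  have hgl := hQ.length_le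
  have hlen : (inp a ++ [f a]).length = n + 1 := by simp [hn]
  refine ((hf a).seq (hQ.seq ((runs_clear n _).seq (runs_move (i := n + 1) (j := n) (k := n + 2)
    (by omega) (by omega) (by omega) _ ?_)))).congr ?_ fun j => ?_
  · rw [Function.update_of_ne (by omega), load_of_le (by simp [hn])]
  · rw [Function.update_of_ne (by omega), load_append_length _ _ hlen,
      load_append_left _ (by omega), load_append_length _ _ (hn a)]
    simp only [Polynomial.eval_add, Polynomial.eval_mul, Polynomial.eval_one,
      Polynomial.eval_ofNat]
    gcongr
  · rw [load_append_singleton _ _ hlen, load_append_singleton _ _ (hn a),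
      load_append_singleton _ _ (hn a)]
    by_cases h1 : j = n + 1
    · subst h1; simp [load_of_le (l := inp a) (i := n + 1) (by simp [hn])]
    · by_cases h2 : j = n
      · subst h2; simp
      · simp [h1, h2]

theorem Clean.comp {g : α → List Bool} (hn : ∀ a, (inp a).length = n)
    (fs : List (α → List Bool)) (hfs : ∀ f ∈ fs, Clean n inp f)
    (hg : PolyTime (fun a => fs.map (· a)) g) : Clean n inp g := by
  have key : ∀ (fs : List (α → List Bool)) (n : ℕ) (inp : α → List (List Bool)),
      (∀ a, (inp a).length = n) → (∀ f ∈ fs, Clean n inp f) →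
      Clean (n + fs.length) (fun a => inp a ++ fs.map (· a)) g → Clean n inp g := by
    intro fs
    induction fs with
    | nil => intro n inp _ _ h; simpa using h
    | cons f fs ih =>
      intro n inp hn hfs h
      refine (hfs f (by simp)).letIn (ih _ _ (fun a => by simp [hn]) (fun f' hf' =>
        (hfs f' (by simp [hf'])).lift (fun _ => rfl)) ?_)
      convert h using 1
      · simp; omega
      · ext1 a; simp
  refine key fs n inp hn hfs ?_
  -- The arguments of g are the intermediate values stored right after the n inputs.
  refine PolyTime.reindex (fun a => by simp [hn]) ((List.range fs.length).map (n + ·))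
    (fun i hi => by simp at hi; omega) ?_
  convert hg using 2 with a
  refine List.ext_getElem (by simp) fun i h1 h2 => ?_
  simp at h2
  simp only [List.getElem_map, List.getElem_range]
  rw [load_apply, List.getD_eq_getElem _ _ (by simp [hn, h2]),
    List.getElem_append_right (by simp [hn])]
  simp [hn]

/-! ### Elementary string functions -/

theorem Clean.var (hn : ∀ a, (inp a).length = n) (i : ℕ) (hi : i < n) :
    Clean n inp (fun a => load (inp a) i) := by
  refine PolyTime.reindex hn [i] (by simpa using hi) ⟨.skip, 1, fun a => ?_⟩
  exact ⟨1, _, .skip _, by simp [load_apply], by simp⟩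

theorem Clean.nil (hn : ∀ a, (inp a).length = n) : Clean n inp (fun _ => []) :=
  ⟨hn, .skip, 1, fun a => ⟨1, by simp, by rw [load_append_nil]; exact .skip _⟩⟩

theorem Clean.cons {f : α → List Bool} (hf : Clean n inp f) (b : Bool) :
    Clean n inp (fun a => b :: f a) := by
  obtain ⟨hn, P, τ, h⟩ := hf
  refine ⟨hn, .seq P (.push n b), τ + 1, fun a => ?_⟩
  refine ((h a).seq (Runs.push n b _)).congr (by simp) fun i => ?_
  rw [load_append_singleton _ _ (hn a), load_append_singleton _ _ (hn a)]
  simp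

theorem Clean.const (hn : ∀ a, (inp a).length = n) (l : List Bool) :
    Clean n inp (fun _ => l) := by
  induction l with
  | nil => exact Clean.nil hn
  | cons b l ih => exact ih.cons b

theorem Clean.comp₁ {F : List Bool → List Bool} (hF : PolyTime (fun x => [x]) F)
    {f : α → List Bool} (hf : Clean n inp f) : Clean n inp (fun a => F (f a)) :=
  Clean.comp hf.1 [f] (by simpa using hf) (hF.comap f)

theorem Clean.comp₂ {F : List Bool → List Bool → List Bool}
    (hF : PolyTime (fun x : List Bool × List Bool => [x.1, x.2]) (fun x => F x.1 x.2))
    {f g : α → List Bool} (hf : Clean n inp f) (hg : Clean n inp g) :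
    Clean n inp (fun a => F (f a) (g a)) :=
  Clean.comp hf.1 [f, g] (by simp [hf, hg]) (hF.comap fun a => (f a, g a))

theorem Clean.append {f g : α → List Bool} (hf : Clean n inp f) (hg : Clean n inp g) :
    Clean n inp (fun a => f a ++ g a) := by
  refine Clean.comp₂ ⟨.seq (move 0 1 2) (move 1 0 2), 16 * Polynomial.X + 4, fun x => ?_⟩ hf hg
  obtain ⟨t, ht, e⟩ := (runs_move (i := 0) (j := 1) (k := 2) (by simp) (by simp) (by simp)
    (load [x.1, x.2]) rfl).seq (runs_move (i := 1) (j := 0) (k := 2) (by simp) (by simp) (by simp)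
    _ rfl)
  refine ⟨t, _, e, by simp [load_apply], ht.trans ?_⟩
  simp [load_apply, inputSize]
  omega

theorem Clean.tail {f : α → List Bool} (hf : Clean n inp f) : Clean n inp (fun a => (f a).tail) :=
  Clean.comp₁ ⟨.pop 0, 1, fun x => ⟨1, _, .pop 0 _, by simp [load_apply], by simp⟩⟩ hf

theorem Clean.head {f : α → List Bool} (hf : Clean n inp f) :
    Clean n inp (fun a => if (f a).head? = some true then [true] else []) := by
  refine Clean.comp₁ (F := fun x => if x.head? = some true then [true] else [])
    ⟨.branch 0 .skip (clear 0) (.seq (clear 0) (.push 0 true)), 2 * Polynomial.X + 3,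
      fun x => ?_⟩ hf
  obtain ⟨t, ht, e⟩ := runs_clear 0 (load [x])
  match x with
  | [] => exact ⟨_, _, .branch_empty rfl (.skip _), by simp [load_apply], by simp⟩
  | false :: x =>
    refine ⟨_, _, .branch_false rfl e, by simp, ?_⟩
    simp [load_apply, inputSize] at ht ⊢
    omega
  | true :: x =>
    refine ⟨_, _, .branch_true rfl (.seq e (.push 0 true _)), by simp, ?_⟩
    simp [load_apply, inputSize] at ht ⊢
    omega

theorem Clean.length {f : α → List Bool} (hf : Clean n inp f) :
    Clean n inp (fun a => unary (f a).length) := by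
  refine Clean.comp₁ (F := fun x => unary x.length)
    ⟨.seq (.loop 0 (.seq (.pop 0) (.push 1 true))) (moveRev 1 0), 7 * Polynomial.X + 2,
      fun x => ?_⟩ hf
  have key : ∀ (x : List Bool) (m : ℕ), Runs (.loop 0 (.seq (.pop 0) (.push 1 true)))
      (load [x, unary m]) (load [[], unary (m + x.length)]) (3 * x.length + 1) := by
    intro x
    induction x with
    | nil => exact fun m => ⟨1, by simp, .loop_done rfl⟩
    | cons b x ih =>
      intro m
      obtain ⟨t, ht, e⟩ := ih (m + 1)
      refine ⟨1 + 1 + t + 1, by simp; omega, .loop_step (by simp [load_apply])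
        (.seq (.pop 0 _) (.push 1 true _)) ?_⟩
      convert e using 1
      · ext1 i
        match i with
        | 0 => simp [load_apply]
        | 1 => simp [load_apply, unary, List.replicate_succ]
        | i + 2 => simp [load_apply]
      · simp; ring_nf
  have h0 := key x 0
  rw [show load [x, unary 0] = load [x] from load_append_nil [x]] at h0
  obtain ⟨t, ht, e⟩ := h0.seq (runs_moveRev (i := 1) (j := 0) (by simp) _)
  refine ⟨t, _, e, by simp [load_apply, unary], ht.trans ?_⟩
  simp [load_apply, inputSize, unary]
  omega

theorem Clean.drop {f : α → ℕ} {g : α → List Bool} (hf : Clean n inp (fun a => unary (f a)))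
    (hg : Clean n inp g) : Clean n inp (fun a => (g a).drop (f a)) := by
  have h := Clean.comp₂ (F := fun x y => y.drop x.length)
    ⟨.seq (.loop 0 (.seq (.pop 0) (.pop 1))) (move 1 0 2), 11 * Polynomial.X + 3,
      fun x => ?_⟩ hf hg
  · simpa [length_unary] using h
  obtain ⟨x, y⟩ := x
  have key : ∀ (x y : List Bool), Runs (.loop 0 (.seq (.pop 0) (.pop 1)))
      (load [x, y]) (load [[], y.drop x.length]) (3 * x.length + 1) := by
    intro x
    induction x with
    | nil => exact fun m => ⟨1, by simp, .loop_done rfl⟩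
    | cons b x ih =>
      intro y
      obtain ⟨t, ht, e⟩ := ih y.tail
      refine ⟨1 + 1 + t + 1, by simp; omega, .loop_step (by simp [load_apply])
        (.seq (.pop 0 _) (.pop 1 _)) ?_⟩
      convert e using 1
      · ext1 i
        match i with
        | 0 => simp [load_apply]
        | 1 => simp [load_apply]
        | i + 2 => simp [load_apply]
      · simp [List.drop_tail]
  obtain ⟨t, ht, e⟩ := (key x y).seq (runs_move (i := 1) (j := 0) (k := 2) (by simp) (by simp)
    (by simp) _ rfl)
  refine ⟨t, _, e, by simp [load_apply], ht.trans ?_⟩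
  simp [load_apply, inputSize]
  omega

/-- Lazy conditional: each branch only has to be computed where it is taken. -/
theorem Clean.ite {c f g : α → List Bool} {p : α → Prop} [DecidablePred p]
    (hc : Clean n inp c) (hp : ∀ a, p a ↔ c a ≠ [])
    (hf : Clean n (fun a : {a // p a} => inp a) (fun a => f a))
    (hg : Clean n (fun a : {a // ¬ p a} => inp a) (fun a => g a)) :
    Clean n inp (fun a => if p a then f a else g a) := by
  obtain ⟨hn, P, τ, hc⟩ := hc
  obtain ⟨-, Q, τ₁, hf⟩ := hf
  obtain ⟨-, R, τ₂, hg⟩ := hg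
  refine ⟨hn, .seq P (.branch n R (.seq (clear n) Q) (.seq (clear n) Q)),
    τ + (τ₁ + τ₂ + 2 * τ + 2), fun a => ?_⟩
  obtain ⟨t, ht, e⟩ := hc a
  have hcl := (hc a).length_le
  have hcn := load_append_length (inp a) (c a) (hn a)
  by_cases h : p a
  · simp only [if_pos h]
    obtain ⟨t₁, ht₁, e₁⟩ := runs_clear n (load (inp a ++ [c a]))
    rw [hcn] at ht₁
    obtain ⟨t₂, ht₂, e₂⟩ := hf ⟨a, h⟩
    have hup : Function.update (load (inp a ++ [c a])) n [] = load (inp a) := by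
      rw [load_append_singleton _ _ (hn a), Function.update_idem]
      exact Function.update_eq_self_iff.2 (load_of_le (hn a).le).symm
    rw [hup] at e₁
    have e₃ : Exec (.branch n R (.seq (clear n) Q) (.seq (clear n) Q)) (load (inp a ++ [c a]))
        (t₁ + t₂ + 1) (load (inp a ++ [f a])) := by
      obtain ⟨b, l, hbl⟩ := List.exists_cons_of_ne_nil ((hp a).1 h)
      cases b
      · exact .branch_false (by rw [hcn, hbl]; rfl) (.seq e₁ e₂)
      · exact .branch_true (by rw [hcn, hbl]; rfl) (.seq e₁ e₂)
    refine ⟨_, ?_, .seq e e₃⟩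
    simp at ht ht₂ ⊢
    omega
  · simp only [if_neg h]
    obtain ⟨t₂, ht₂, e₂⟩ := hg ⟨a, h⟩
    have hnil : c a = [] := by
      by_contra h'
      exact h ((hp a).2 h')
    refine ⟨_, ?_, .seq e (.branch_empty (by rw [hcn, hnil]) (s' := load (inp a ++ [g a]))
      (t := t₂) ?_)⟩
    · simp at ht ht₂ ⊢
      omega
    · rw [hnil, load_append_nil]
      exact e₂

/-- The unary counter in register n is decremented before each call and serves as the loop index.
The indices run downwards, and each new block is put in front of the accumulator, so the blocks end
up in increasing order. -/
theorem Clean.flatMap {N : α → ℕ} {g : α → ℕ → List Bool}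
    (hN : Clean n inp (fun a => unary (N a)))
    (hg : Clean (n + 1) (fun b : α × ℕ => inp b.1 ++ [unary b.2]) (fun b => g b.1 b.2)) :
    Clean n inp (fun a => (List.range (N a)).flatMap (g a)) := by
  obtain ⟨hn, P, τ, hN⟩ := hN
  obtain ⟨-, Q, τ', hg⟩ := hg
  -- The accumulator lies beyond every register the body mentions, so the frame property protects
  -- it; registers n + 1 and n + 2 are needed for moving blocks.
  set K := max Q.bound (n + 3) with hK
  have hKn : n + 3 ≤ K := le_max_right _ _
  let τ₂ := τ'.comp (Polynomial.X + τ)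
  refine ⟨hn, .seq P (.seq (.loop n (.seq (.pop n) (.seq Q (.seq (moveRev (n + 1) (n + 2))
    (moveRev (n + 2) K))))) (move K n (n + 1))),
    τ + (τ * (8 * τ₂ + τ₂ + 4) + 1 + (8 * (τ * τ₂) + 2)), fun a => ?_⟩
  set T := τ₂.eval (inputSize (inp a)) with hT
  have hNl : N a ≤ τ.eval (inputSize (inp a)) := by
    simpa [length_unary] using (hN a).length_le
  have hQ : ∀ i ≤ N a, Runs Q (load (inp a ++ [unary i]))
      (load (inp a ++ [unary i] ++ [g a i])) T := fun i hi => by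
    refine (hg (a, i)).mono ?_
    simp only [hT, τ₂, Polynomial.eval_comp, inputSize_append, inputSize_singleton,
      Polynomial.eval_add, Polynomial.eval_X, length_unary]
    exact eval_mono _ (by omega)
  have hgl : ∀ i ≤ N a, (g a i).length ≤ T := fun i hi => (hQ i hi).length_le
  have hlen : ∀ i, (inp a ++ [unary i]).length = n + 1 := by simp [hn]
  have loop : ∀ i ≤ N a, ∀ acc, Runs (.loop n (.seq (.pop n) (.seq Q
      (.seq (moveRev (n + 1) (n + 2)) (moveRev (n + 2) K)))))
      (Function.update (load (inp a ++ [unary i])) K acc)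
      (Function.update (load (inp a)) K ((List.range i).flatMap (g a) ++ acc))
      (i * (8 * T + T + 4) + 1) := by
    intro i
    induction i with
    | zero =>
      intro _ acc
      rw [show unary 0 = [] from rfl, load_append_nil]
      refine ⟨1, by simp, .loop_done ?_⟩
      rw [Function.update_of_ne (by omega), load_of_le (hn a).le]
    | succ i ih =>
      intro hi acc
      obtain ⟨t₁, ht₁, e₁⟩ := hQ i (by omega)
      obtain ⟨S, e₂, h₂, f₂⟩ := e₁.frame (k := K) (le_max_left _ _)
        (S := Function.update (load (inp a ++ [unary i])) K acc)
        (fun j hj => Function.update_of_ne hj.ne _ _)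
      have hS : S = Function.update (load (inp a ++ [unary i] ++ [g a i])) K acc := by
        ext1 j
        rcases lt_trichotomy j K with h | h | h
        · rw [h₂ j h, Function.update_of_ne h.ne]
        · subst h; rw [f₂ _ le_rfl]; simp
        · rw [f₂ _ h.le, Function.update_of_ne h.ne', Function.update_of_ne h.ne',
            load_of_le (by simp [hn]; omega), load_of_le (by simp [hn]; omega)]
      have hpop := Runs.pop n (Function.update (load (inp a ++ [unary (i + 1)])) K acc)
      have hst : Function.update (Function.update (load (inp a ++ [unary (i + 1)])) K acc) n
          (Function.update (load (inp a ++ [unary (i + 1)])) K acc n).tail =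
          Function.update (load (inp a ++ [unary i])) K acc := by
        rw [Function.update_of_ne (by omega), load_append_singleton _ _ (hn a),
          load_append_singleton _ _ (hn a)]
        ext1 j
        by_cases h : j = n
        · subst h; simp [show j ≠ K by omega, unary]
        · by_cases h' : j = K
          · subst h'; simp [h]
          · simp [h, h']
      rw [hst] at hpop
      have hm := (runs_moveRev (i := n + 1) (j := n + 2) (by omega) S).seq
        (runs_moveRev (i := n + 2) (j := K) (by omega) _)
      obtain ⟨t, ht, e⟩ := hpop.seq (Runs.seq ⟨t₁, ht₁, e₂⟩ hm)
      obtain ⟨t', ht', e'⟩ := ih (by omega) (g a i ++ acc)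
      have hS1 : S (n + 1) = g a i := by
        rw [hS, Function.update_of_ne (by omega), load_append_length _ _ (hlen i)]
      have hS2 : S (n + 2) = [] := by
        rw [hS, Function.update_of_ne (by omega), load_of_le (by simp [hn])]
      have hSK : S K = acc := by simp [hS]
      refine ⟨t + t' + 1, ?_, .loop_step ?_ e ?_⟩
      · have := hgl i (by omega)
        simp [hS1, hS2] at ht
        rw [Nat.succ_mul]
        omega
      · rw [Function.update_of_ne (by omega), load_append_length _ _ (hn a)]
        simp [unary]
      · convert e' using 1
        · ext1 j
          by_cases h1 : j = n + 1
          · subst h1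
            rw [Function.update_of_ne (by omega), Function.update_of_ne (by omega),
              Function.update_self, Function.update_of_ne (by omega),
              load_of_le (by simp [hn])]
          · by_cases h2 : j = n + 2
            · subst h2
              rw [Function.update_self, Function.update_of_ne (by omega),
                load_of_le (by simp [hn])]
            · by_cases h3 : j = K
              · subst h3
                simp only [Function.update_self, ne_eq, h1, h2, not_false_eq_true,
                  Function.update_of_ne]
                simp [hS1, hS2, hSK]
              · simp only [ne_eq, h1, h2, h3, not_false_eq_true, Function.update_of_ne]
                rw [hS, Function.update_of_ne h3, load_append_singleton _ _ (hlen i),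
                  Function.update_of_ne h1]
        · simp [List.range_succ]
  have h0 := loop (N a) le_rfl []
  rw [show Function.update (load (inp a ++ [unary (N a)])) K [] = load (inp a ++ [unary (N a)])
    from Function.update_eq_self_iff.2 (load_of_le (by simp [hn]; omega)).symm,
    List.append_nil] at h0
  have hfl : ((List.range (N a)).flatMap (g a)).length ≤ N a * T := by
    rw [List.length_flatMap]
    calc _ ≤ ((List.range (N a)).map fun _ => T).sum :=
          List.sum_le_sum fun i hi => hgl i (List.mem_range.1 hi).le
      _ = _ := by simp
  refine ((hN a).seq (h0.seq (runs_move (i := K) (j := n) (k := n + 1) (by omega) (by omega)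
    (by omega) _ ?_))).congr ?_ fun j => ?_
  · rw [Function.update_of_ne (by omega), load_of_le (by simp [hn])]
  · rw [Function.update_self]
    simp only [Polynomial.eval_add, Polynomial.eval_mul, Polynomial.eval_one,
      Polynomial.eval_ofNat, ← hT]
    gcongr
    exact hfl.trans (by gcongr)
  · rw [load_append_singleton _ _ (hn a)]
    by_cases h1 : j = K
    · subst h1
      rw [Function.update_self, Function.update_of_ne (by omega), load_of_le (by simp [hn]; omega)]
    · by_cases h2 : j = n
      · subst h2
        rw [Function.update_self, Function.update_of_ne h1, Function.update_self,
          Function.update_self, Function.update_of_ne h1, load_of_le (hn a).le, List.append_nil]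
      · simp [h1, h2]

/-! ## Arithmetic in unary and decision procedures -/

open Classical in
/-- Some polynomial-time program decides the predicate `p`. -/
def Decides (n : ℕ) (inp : α → List (List Bool)) (p : α → Prop) : Prop :=
  Clean n inp (fun a => if p a then [true] else [])

theorem Decides.congr {p q : α → Prop} (h : Decides n inp p) (hpq : ∀ a, q a ↔ p a) :
    Decides n inp q := by
  rwa [funext fun a => propext (hpq a)]

theorem Clean.ite_of_decides {p : α → Prop} [DecidablePred p] (hp : Decides n inp p)
    {f g : α → List Bool} (hf : Clean n (fun a : {a // p a} => inp a) (fun a => f a))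
    (hg : Clean n (fun a : {a // ¬ p a} => inp a) (fun a => g a)) :
    Clean n inp (fun a => if p a then f a else g a) :=
  Clean.ite hp (fun a => by by_cases h : p a <;> simp [h]) hf hg

theorem Clean.cond {p : α → Prop} [DecidablePred p] (hp : Decides n inp p) {f g : α → List Bool}
    (hf : Clean n inp f) (hg : Clean n inp g) : Clean n inp (fun a => if p a then f a else g a) :=
  Clean.ite_of_decides hp (hf.comap Subtype.val) (hg.comap Subtype.val)

theorem Clean.decides_ne_nil {f : α → List Bool} (hf : Clean n inp f) :
    Decides n inp (fun a => f a ≠ []) := by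
  classical
  unfold Decides
  convert Clean.ite (p := fun a => f a ≠ []) (f := fun _ => [true]) (g := fun _ => []) hf
    (fun a => Iff.rfl) ((Clean.const hf.1 [true]).comap Subtype.val)
    ((Clean.nil hf.1).comap Subtype.val)

theorem Decides.not {p : α → Prop} (hp : Decides n inp p) : Decides n inp (fun a => ¬ p a) := by
  classical
  have := Clean.cond hp (Clean.nil hp.1) (Clean.const hp.1 [true])
  unfold Decides
  convert this using 2 with a
  by_cases h : p a <;> simp [h]

theorem Decides.and {p q : α → Prop} (hp : Decides n inp p) (hq : Decides n inp q) :
    Decides n inp (fun a => p a ∧ q a) := by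
  classical
  have := Clean.cond hp hq (Clean.nil hp.1)
  unfold Decides
  convert this using 2 with a
  by_cases h : p a <;> simp [h]

theorem Decides.or {p q : α → Prop} (hp : Decides n inp p) (hq : Decides n inp q) :
    Decides n inp (fun a => p a ∨ q a) :=
  (hp.not.and hq.not).not.congr fun a => by tauto

theorem Decides.const (hn : ∀ a, (inp a).length = n) (p : Prop) :
    Decides n inp (fun _ => p) := by
  classical
  exact Clean.const hn (if p then [true] else [])

theorem Clean.decides_head {f : α → List Bool} (hf : Clean n inp f) :
    Decides n inp (fun a => (f a).head? = some true) := by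
  unfold Decides
  convert hf.head

theorem Clean.decides_bit {f : α → Bool} (hf : Clean n inp (fun a => [f a])) :
    Decides n inp (fun a => f a = true) :=
  hf.decides_head.congr fun a => by simp

theorem Decides.bit {p : α → Prop} [DecidablePred p] (hp : Decides n inp p) :
    Clean n inp (fun a => [decide (p a)]) := by
  have := Clean.cond hp (Clean.const hp.1 [true]) (Clean.const hp.1 [false])
  convert this using 2 with a
  by_cases h : p a <;> simp [h]

/-- Membership of short strings in any language is decided by a lookup table. -/
theorem Clean.decides_short {f : α → List Bool} (hf : Clean n inp f) (N : ℕ)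
    (L : Set (List Bool)) : Decides n inp (fun a => (f a).length < N ∧ f a ∈ L) := by
  induction N generalizing f L with
  | zero => exact (Decides.const hf.1 False).congr fun a => by simp
  | succ N ih =>
    have h0 := hf.decides_ne_nil.not.and (Decides.const hf.1 ([] ∈ L))
    have h1 := hf.decides_head.and (ih hf.tail {x | true :: x ∈ L})
    have h2 := (hf.decides_ne_nil.and hf.decides_head.not).and (ih hf.tail {x | false :: x ∈ L})
    refine (h0.or (h1.or h2)).congr fun a => ?_
    rcases f a with _ | ⟨_ | _, l⟩ <;> simp

theorem Clean.ext_left {f : α → List Bool} (hf : Clean n inp f) :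
    Clean (n + 1) (fun b : α × ℕ => inp b.1 ++ [unary b.2]) (fun b => f b.1) :=
  (hf.comap Prod.fst).lift fun _ => rfl

theorem Clean.ext_right (hn : ∀ a, (inp a).length = n) :
    Clean (n + 1) (fun b : α × ℕ => inp b.1 ++ [unary b.2]) (fun b => unary b.2) := by
  have := Clean.var (n := n + 1) (inp := fun b : α × ℕ => inp b.1 ++ [unary b.2])
    (fun b => by simp [hn]) n (by omega)
  simpa only [load_append_length _ _ (hn _)] using this

/-- Some polynomial-time program computes the number `f a` in unary. -/
abbrev Computes (n : ℕ) (inp : α → List (List Bool)) (f : α → ℕ) : Prop :=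
  Clean n inp (fun a => unary (f a))

theorem Computes.const (hn : ∀ a, (inp a).length = n) (c : ℕ) : Computes n inp (fun _ => c) :=
  Clean.const hn (unary c)

theorem unary_add (a b : ℕ) : unary (a + b) = unary a ++ unary b := by
  simp [unary, List.replicate_append_replicate]

theorem unary_mul (a b : ℕ) : unary (a * b) = (List.range a).flatMap fun _ => unary b := by
  induction a with
  | zero => simp [unary]
  | succ a ih =>
    rw [List.range_succ, List.flatMap_append, ← ih, Nat.succ_mul, unary_add]
    simp

theorem unary_sub (a b : ℕ) : unary (a - b) = (unary a).drop b := by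
  simp [unary, List.drop_replicate]

theorem Computes.add {f g : α → ℕ} (hf : Computes n inp f) (hg : Computes n inp g) :
    Computes n inp (fun a => f a + g a) := by
  simpa only [← unary_add] using Clean.append hf hg

theorem Computes.mul {f g : α → ℕ} (hf : Computes n inp f) (hg : Computes n inp g) :
    Computes n inp (fun a => f a * g a) := by
  simpa only [← unary_mul] using
    Clean.flatMap (g := fun a _ => unary (g a)) hf (Clean.ext_left hg)

theorem Computes.sub {f g : α → ℕ} (hf : Computes n inp f) (hg : Computes n inp g) :
    Computes n inp (fun a => f a - g a) := by
  simpa only [← unary_sub] using Clean.drop hg hf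

theorem Computes.decides_le {f g : α → ℕ} (hf : Computes n inp f) (hg : Computes n inp g) :
    Decides n inp (fun a => f a ≤ g a) :=
  (hf.sub hg).decides_ne_nil.not.congr fun a => by simp [unary]; omega

theorem Computes.decides_eq {f g : α → ℕ} (hf : Computes n inp f) (hg : Computes n inp g) :
    Decides n inp (fun a => f a = g a) :=
  ((hf.decides_le hg).and (hg.decides_le hf)).congr fun _ => le_antisymm_iff

theorem Computes.polynomial {f : α → ℕ} (hf : Computes n inp f) (π : Polynomial ℕ) :
    Computes n inp (fun a => π.eval (f a)) := by
  induction π using Polynomial.induction_on' with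
  | add p q hp hq => simpa using hp.add hq
  | monomial d c =>
    have hpow : ∀ d, Computes n inp (fun a => f a ^ d) := by
      intro d
      induction d with
      | zero => simpa using Computes.const hf.1 1
      | succ d ih => simpa [pow_succ] using ih.mul hf
    simpa using (Computes.const hf.1 c).mul (hpow d)

open Classical in
/-- Search for the number of initial successes. -/
theorem Computes.count {f k : α → ℕ} {p : α → ℕ → Prop} (hf : Computes n inp f)
    (hp : Decides (n + 1) (fun b : α × ℕ => inp b.1 ++ [unary b.2]) (fun b => p b.1 b.2))
    (hk : ∀ a, k a ≤ f a) (hpk : ∀ a t, p a t ↔ t < k a) : Computes n inp k := by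
  have h := Clean.flatMap (g := fun a t => if p a t then [true] else []) hf hp
  convert h using 2 with a
  have key : ∀ m j, (List.range m).flatMap (fun t => if t < j then [true] else []) =
      unary (min m j) := by
    intro m j
    induction m with
    | zero => simp [unary]
    | succ m ih =>
      rw [List.range_succ, List.flatMap_append, ih]
      by_cases h : m < j
      · rw [min_eq_left h.le, min_eq_left (by omega)]
        simp [h, unary, List.replicate_succ']
      · rw [min_eq_right (by omega), min_eq_right (by omega)]
        simp [h]
  simp only [hpk]
  rw [key, min_eq_right (hk a)]

/-- The quotient is the number of t with (t + 1)·g ≤ f, and these t form an initial segment, so a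
bounded search counts them. -/
theorem Computes.div {f g : α → ℕ} (hf : Computes n inp f) (hg : Computes n inp g)
    (hpos : ∀ a, 0 < g a) : Computes n inp (fun a => f a / g a) := by
  refine Computes.count (p := fun a t => (t + 1) * g a ≤ f a) hf ?_
    (fun a => Nat.div_le_self _ _) (fun a t => ?_)
  · have ht := Clean.ext_right hf.1
    exact ((Computes.add ht (Computes.const ht.1 1)).mul (Clean.ext_left hg)).decides_le
      (Clean.ext_left hf)
  · rw [← Nat.le_div_iff_mul_le (hpos a)]
    exact Nat.succ_le_iff

theorem Computes.mod {f g : α → ℕ} (hf : Computes n inp f) (hg : Computes n inp g)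
    (hpos : ∀ a, 0 < g a) : Computes n inp (fun a => f a % g a) := by
  have h := hf.sub (hg.mul (hf.div hg hpos))
  convert h using 3 with a
  have := Nat.mod_add_div (f a) (g a)
  omega

theorem Computes.sqrt {f : α → ℕ} (hf : Computes n inp f) :
    Computes n inp (fun a => Nat.sqrt (f a)) := by
  refine Computes.count (p := fun a t => (t + 1) * (t + 1) ≤ f a) hf ?_
    (fun a => Nat.sqrt_le_self _) (fun a t => ?_)
  · have ht := Clean.ext_right hf.1
    have ht' := Computes.add ht (Computes.const ht.1 1)
    exact (ht'.mul ht').decides_le (Clean.ext_left hf)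
  · rw [← Nat.le_sqrt]
    exact Nat.succ_le_iff

end

/-! ## Strategies from short lists of answers -/

/-- Answer each question by the most popular answer. -/
theorem exists_popular {R Q A : Type} [Fintype R] [Fintype Q] [DecidableEq Q] [DecidableEq A]
    [Nonempty A] (W : R → ℝ) (q : R → Q) (a : R → A) (Λ : Q → Finset A)
    (ha : ∀ r, a r ∈ Λ (q r)) :
    ∃ P : Q → A, ∑ r, W r / (Λ (q r)).card ≤ ∑ r, if a r = P (q r) then W r else 0 := by
  have key : ∀ y : Q, ∃ b : A, ∑ r with q r = y, W r / (Λ y).card ≤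
      ∑ r with q r = y, if a r = b then W r else 0 := by
    intro y
    rcases (Λ y).eq_empty_or_nonempty with h | h
    · refine ⟨Classical.arbitrary A, ?_⟩
      have : (Finset.univ.filter fun r => q r = y) = ∅ := by
        refine Finset.filter_eq_empty_iff.2 fun r _ hr => ?_
        have := ha r
        rw [hr, h] at this
        simp at this
      simp [this]
    · by_contra hcon
      push Not at hcon
      -- Summed over all b in the list, each r with question y is counted exactly once, at b = a r.
      -- So not every b can fall below the average.
      have h1 := Finset.sum_lt_sum_of_nonempty h fun b _ => hcon b
      rw [Finset.sum_comm] at h1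
      have h2 : ∀ r ∈ Finset.univ.filter (fun r => q r = y),
          (∑ b ∈ Λ y, if a r = b then W r else 0) = W r := by
        intro r hr
        rw [Finset.mem_filter] at hr
        rw [Finset.sum_ite_eq, if_pos (hr.2 ▸ ha r)]
      rw [Finset.sum_congr rfl h2, Finset.sum_const, nsmul_eq_mul, ← Finset.sum_div] at h1
      have : ((Λ y).card : ℝ) ≠ 0 := by simpa using h.ne_empty
      rw [mul_div_cancel₀ _ this] at h1
      exact lt_irrefl _ h1
  choose P hP using key
  refine ⟨P, ?_⟩
  rw [← Finset.sum_fiberwise Finset.univ q, ← Finset.sum_fiberwise Finset.univ q]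
  refine Finset.sum_le_sum fun y _ => ?_
  calc _ = ∑ r with q r = y, W r / (Λ y).card :=
        Finset.sum_congr rfl fun r hr => by rw [(Finset.mem_filter.1 hr).2]
    _ ≤ _ := hP y
    _ = _ := Finset.sum_congr rfl fun r hr => by rw [(Finset.mem_filter.1 hr).2]

/-- All fibres of the query map have the same size |R|/|Q₁|. -/
theorem Verifier.Uniformity.sum_query₁ {V : Verifier} (hV : V.Uniformity) (x : List Bool)
    (f : Fin (V.nQ₁ x) → ℝ) :
    ∑ r, f (V.query₁ x r) = V.nR x / V.nQ₁ x * ∑ q, f q := by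
  have hR : (V.nR x : ℝ) ≠ 0 := by exact_mod_cast (V.nR_pos x).ne'
  rw [← Finset.sum_fiberwise Finset.univ (V.query₁ x), Finset.mul_sum]
  refine Finset.sum_congr rfl fun q _ => ?_
  have h := (hV x).1 q
  rw [Finset.sum_congr rfl fun r hr => by rw [(Finset.mem_filter.1 hr).2], Finset.sum_const,
    nsmul_eq_mul]
  rw [div_eq_iff hR] at h
  rw [h]; ring

theorem Verifier.Uniformity.sum_query₂ {V : Verifier} (hV : V.Uniformity) (x : List Bool)
    (f : Fin (V.nQ₂ x) → ℝ) :
    ∑ r, f (V.query₂ x r) = V.nR x / V.nQ₂ x * ∑ q, f q := by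
  have hR : (V.nR x : ℝ) ≠ 0 := by exact_mod_cast (V.nR_pos x).ne'
  rw [← Finset.sum_fiberwise Finset.univ (V.query₂ x), Finset.mul_sum]
  refine Finset.sum_congr rfl fun q _ => ?_
  have h := (hV x).2 q
  rw [Finset.sum_congr rfl fun r hr => by rw [(Finset.mem_filter.1 hr).2], Finset.sum_const,
    nsmul_eq_mul]
  rw [div_eq_iff hR] at h
  rw [h]; ring

theorem Verifier.nQ₁_pos (V : Verifier) (x : List Bool) : 0 < V.nQ₁ x :=
  (Nat.zero_le _).trans_lt (V.query₁ x ⟨0, V.nR_pos x⟩).2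

theorem Verifier.nQ₂_pos (V : Verifier) (x : List Bool) : 0 < V.nQ₂ x :=
  (Nat.zero_le _).trans_lt (V.query₂ x ⟨0, V.nR_pos x⟩).2

/-- By the AM-GM inequality 1/(st) ≥ 4/(s+t)², and the left side is the tangent at y = a of the
convex function 4/y², taken at y = s + t. A linear lower bound lets Jensen's inequality be applied
by plain summation. -/
theorem inv_mul_ge {a s t : ℝ} (ha : 0 < a) (hs : 0 < s) (ht : 0 < t) :
    12 / a ^ 2 - 8 * (s + t) / a ^ 3 ≤ 1 / s / t := by
  have h1 : 4 / (s + t) ^ 2 ≤ 1 / s / t := by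
    rw [div_div, div_le_div_iff₀ (by positivity) (by positivity)]
    nlinarith [sq_nonneg (s - t)]
  refine le_trans ?_ h1
  set y := s + t with hy
  have hy0 : 0 < y := by positivity
  have : 4 / y ^ 2 - (12 / a ^ 2 - 8 * y / a ^ 3) =
      4 * ((a - y) ^ 2 * (a + 2 * y)) / (a ^ 3 * y ^ 2) := by
    field_simp
    ring
  have : 0 ≤ 4 / y ^ 2 - (12 / a ^ 2 - 8 * y / a ^ 3) := by rw [this]; positivity
  linarith

/-- Lists of answers that are short on average and always contain an accepted pair yield good
strategies. -/
theorem Verifier.exists_value_ge {V : Verifier} (hV : V.Uniformity) (x : List Bool)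
    (Λ₁ : Fin (V.nQ₁ x) → Finset (Fin (V.nA₁ x))) (Λ₂ : Fin (V.nQ₂ x) → Finset (Fin (V.nA₂ x)))
    (hΛ : ∀ r, ∃ a₁ ∈ Λ₁ (V.query₁ x r), ∃ a₂ ∈ Λ₂ (V.query₂ x r), V.accept x r a₁ a₂ = true)
    {a : ℝ} (ha : 0 < a)
    (hle : (∑ q, ((Λ₁ q).card : ℝ)) / V.nQ₁ x + (∑ q, ((Λ₂ q).card : ℝ)) / V.nQ₂ x ≤ a) :
    ∃ P₁ P₂, 4 / a ^ 2 ≤ V.value x P₁ P₂ := by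
  choose a₁ ha₁ a₂ ha₂ hacc using hΛ
  have : Nonempty (Fin (V.nA₁ x)) := ⟨⟨0, V.nA₁_pos x⟩⟩
  have : Nonempty (Fin (V.nA₂ x)) := ⟨⟨0, V.nA₂_pos x⟩⟩
  -- Independent uniform choices from the lists hit the accepted pair of r with probability
  -- 1/(|Λ₁||Λ₂|). The choices are fixed one prover at a time: the first with weights 1/|Λ₂|, the
  -- second counting only the r on which the first choice is right.
  obtain ⟨P₁, h₁⟩ := exists_popular (fun r => 1 / ((Λ₂ (V.query₂ x r)).card : ℝ)) (V.query₁ x) a₁ Λ₁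
    ha₁
  obtain ⟨P₂, h₂⟩ := exists_popular (fun r => if a₁ r = P₁ (V.query₁ x r) then (1 : ℝ) else 0)
    (V.query₂ x) a₂ Λ₂ ha₂
  refine ⟨P₁, P₂, ?_⟩
  have hR : (0 : ℝ) < V.nR x := by exact_mod_cast V.nR_pos x
  rw [Verifier.value, le_div_iff₀ hR]
  have h3 : (∑ r, if a₂ r = P₂ (V.query₂ x r) then
      (if a₁ r = P₁ (V.query₁ x r) then (1 : ℝ) else 0) else 0) ≤
      ((Finset.univ.filter fun r : Fin (V.nR x) =>
        V.accept x r (P₁ (V.query₁ x r)) (P₂ (V.query₂ x r)) = true).card : ℝ) := by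
    rw [Finset.card_filter, Nat.cast_sum]
    refine Finset.sum_le_sum fun r _ => ?_
    by_cases e₂ : a₂ r = P₂ (V.query₂ x r)
    · by_cases e₁ : a₁ r = P₁ (V.query₁ x r)
      · rw [if_pos e₂, if_pos e₁, if_pos (by rw [← e₁, ← e₂]; exact hacc r), Nat.cast_one]
      · simp only [if_pos e₂, if_neg e₁]; positivity
    · simp only [if_neg e₂]; positivity
  refine le_trans ?_ h3
  refine le_trans ?_ h₂
  have h4 : (∑ r, (if a₁ r = P₁ (V.query₁ x r) then (1 : ℝ) else 0) / (Λ₂ (V.query₂ x r)).card) =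
      ∑ r, if a₁ r = P₁ (V.query₁ x r) then 1 / ((Λ₂ (V.query₂ x r)).card : ℝ) else 0 :=
    Finset.sum_congr rfl fun r _ => by split_ifs <;> simp
  rw [h4]
  refine le_trans ?_ h₁
  have hpos₁ : ∀ r, (0 : ℝ) < (Λ₁ (V.query₁ x r)).card := fun r => by
    exact_mod_cast Finset.card_pos.2 ⟨_, ha₁ r⟩
  have hpos₂ : ∀ r, (0 : ℝ) < (Λ₂ (V.query₂ x r)).card := fun r => by
    exact_mod_cast Finset.card_pos.2 ⟨_, ha₂ r⟩
  -- After averaging over r, uniformity replaces the list lengths by their averages over questions,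
  -- and what remains is 12/a² - 8a/a³ = 4/a².
  refine le_trans ?_ (Finset.sum_le_sum fun r _ => inv_mul_ge ha (hpos₂ r) (hpos₁ r))
  rw [Finset.sum_sub_distrib, Finset.sum_const, ← Finset.sum_div, ← Finset.mul_sum, Finset.sum_add_distrib,
    hV.sum_query₁ x fun q => ((Λ₁ q).card : ℝ), hV.sum_query₂ x fun q => ((Λ₂ q).card : ℝ)]
  simp only [Finset.card_univ, Fintype.card_fin, nsmul_eq_mul]
  have h5 : (V.nR x / V.nQ₂ x * ∑ q, ((Λ₂ q).card : ℝ)) + V.nR x / V.nQ₁ x *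
      ∑ q, ((Λ₁ q).card : ℝ) ≤ V.nR x * a := by
    refine le_trans (le_of_eq ?_) (mul_le_mul_of_nonneg_left hle hR.le)
    ring
  have h6 : 8 * ((V.nR x / V.nQ₂ x * ∑ q, ((Λ₂ q).card : ℝ)) + V.nR x / V.nQ₁ x *
      ∑ q, ((Λ₁ q).card : ℝ)) / a ^ 3 ≤ 8 * (V.nR x * a) / a ^ 3 := by gcongr
  have h7 : V.nR x * (12 / a ^ 2) - 8 * (V.nR x * a) / a ^ 3 = 4 / a ^ 2 * V.nR x := by
    field_simp
    ring
  linarith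

/-! ## Sums over blocks -/

theorem sum_range_blocks {M : Type} [AddCommMonoid M] (f : ℕ → M) (k n : ℕ) :
    ∑ u ∈ Finset.range k, ∑ a ∈ Finset.range n, f (u * n + a) =
      ∑ j ∈ Finset.range (k * n), f j := by
  induction k with
  | zero => simp
  | succ k ih => rw [Finset.sum_range_succ, ih, Nat.succ_mul, Finset.sum_range_add]

theorem sum_range_block (X : ℕ → ℝ) (c : ℕ → Prop) [DecidablePred c] {n u p : ℕ} (hn : 0 < n)
    (hp : (u + 1) * n ≤ p) :
    (∑ j ∈ Finset.range p, if j / n = u ∧ c (j % n) then X j else 0) =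
      ∑ a ∈ Finset.range n, if c a then X (u * n + a) else 0 := by
  have hsub : Finset.Ico (u * n) (u * n + n) ⊆ Finset.range p := by
    intro j hj
    rw [Nat.succ_mul] at hp
    simp at hj ⊢
    omega
  rw [← Finset.sum_subset hsub, Finset.sum_Ico_eq_sum_range, Nat.add_sub_cancel_left]
  · refine Finset.sum_congr rfl fun a ha => ?_
    rw [Finset.mem_range] at ha
    rw [Nat.add_comm (u * n) a, Nat.add_mul_div_right _ _ hn, Nat.div_eq_of_lt ha,
      Nat.add_mul_mod_self_right, Nat.mod_eq_of_lt ha]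
    simp
  · intro j _ hj
    refine if_neg fun h => hj ?_
    have h1 := Nat.div_add_mod j n
    have h2 := Nat.mod_lt j hn
    rw [h.1, Nat.mul_comm] at h1
    simp
    omega

/-- Some block has at most its share of a sum. -/
theorem exists_block_le (L : ℕ → ℕ) {n H : ℕ} (hn : 0 < n) (hH : n ≤ H) :
    ∃ t, t < H / n ∧ (H / n) * ∑ q ∈ Finset.range n, L (t * n + q) ≤ ∑ u ∈ Finset.range H, L u := by
  have hpos : 0 < H / n := Nat.div_pos hH hn
  obtain ⟨t, ht, hmin⟩ := Finset.exists_min_image (Finset.range (H / n))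
    (fun t => ∑ q ∈ Finset.range n, L (t * n + q)) ⟨0, by simpa using hpos⟩
  refine ⟨t, Finset.mem_range.1 ht, ?_⟩
  -- The minimal block is at most the average over the H / n complete blocks; the incomplete
  -- remainder is only dropped from the sum.
  have h1 := Finset.card_nsmul_le_sum _ _ _ hmin
  rw [Finset.card_range, smul_eq_mul, sum_range_blocks] at h1
  refine h1.trans (Finset.sum_le_sum_of_subset (Finset.range_subset_range.2 ?_))
  exact Nat.div_mul_le_self _ _

/-! ## The matrix -/

namespace Verifier

variable (V : Verifier) (x : List Bool) (H : ℕ)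

/-- Reduction of a number to a random string of the verifier. -/
def rand (i : ℕ) : Fin (V.nR x) := ⟨i % V.nR x, Nat.mod_lt _ (V.nR_pos x)⟩

/-- Reduction of a number to an answer of the first prover. -/
def ans₁ (j : ℕ) : Fin (V.nA₁ x) := ⟨j % V.nA₁ x, Nat.mod_lt _ (V.nA₁_pos x)⟩

/-- Reduction of a number to an answer of the second prover. -/
def ans₂ (j : ℕ) : Fin (V.nA₂ x) := ⟨j % V.nA₂ x, Nat.mod_lt _ (V.nA₂_pos x)⟩

/-- The copies `u` and `v` of questions are those asked under `r`, and `b` is an answer. -/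
def Edge (r : Fin (V.nR x)) (u v b : ℕ) : Prop :=
  (u % V.nQ₁ x = V.query₁ x r ∧ v % V.nQ₂ x = V.query₂ x r) ∧ b < V.nA₂ x

/-- The row `(r, u, v, b)` contains the column `j`.  The columns are the pairs of one of `H` copies of
questions to the first prover and an answer, followed by those for the second prover. -/
def Entry (r : Fin (V.nR x)) (u v b j : ℕ) : Prop :=
  (j / V.nA₁ x = u ∧ V.Edge x r u v b ∧ V.accept x r (V.ans₁ x j) (V.ans₂ x b) = true) ∨
  (H * V.nA₁ x ≤ j ∧ (j - H * V.nA₁ x) / V.nA₂ x = v ∧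
    ¬ (V.Edge x r u v b ∧ (j - H * V.nA₁ x) % V.nA₂ x = b))

/-- Decoding of row numbers. -/
def EntryAt (i j : ℕ) : Prop :=
  V.Entry x H (V.rand x i) (i / V.nR x % H) (i / V.nR x / H % H)
    (i / V.nR x / H / H % (V.nA₂ x + 1)) j

open Classical in
/-- The Boolean matrix of the reduction. -/
noncomputable def matrix (m p : ℕ) : Matrix (Fin m) (Fin p) Bool :=
  fun i j => decide (V.EntryAt x H i j)

/-! ### Row sums -/

variable {V x H}

open Classical in
-- The bounds on u and v keep the two groups of columns apart: the first alternative of `Entry` only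
-- meets columns below H·|A₁|, the second only those from there on. Columns after both groups are
-- padding.
theorem sum_entry {r : Fin (V.nR x)} {u v b p : ℕ} (hu : u < H) (hv : v < H)
    (hp : H * V.nA₁ x + H * V.nA₂ x ≤ p) (X : ℕ → ℝ) :
    (∑ j ∈ Finset.range p, if V.Entry x H r u v b j then X j else 0) =
      (∑ a ∈ Finset.range (V.nA₁ x), if V.Edge x r u v b ∧
        V.accept x r (V.ans₁ x a) (V.ans₂ x b) = true then X (u * V.nA₁ x + a) else 0) +
      ∑ a ∈ Finset.range (V.nA₂ x), if ¬ (V.Edge x r u v b ∧ a = b) then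
        X (H * V.nA₁ x + (v * V.nA₂ x + a)) else 0 := by
  have hA₁ := V.nA₁_pos x
  have hA₂ := V.nA₂_pos x
  have hu' : (u + 1) * V.nA₁ x ≤ H * V.nA₁ x := Nat.mul_le_mul_right _ hu
  have hv' : (v + 1) * V.nA₂ x ≤ H * V.nA₂ x := Nat.mul_le_mul_right _ hv
  obtain ⟨q, rfl⟩ : ∃ q, p = H * V.nA₁ x + q := ⟨p - H * V.nA₁ x, by omega⟩
  have e₁ := sum_range_block X (fun a => V.Edge x r u v b ∧
    V.accept x r (V.ans₁ x a) (V.ans₂ x b) = true) hA₁ hu'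
  have e₂ := sum_range_block (fun j => X (H * V.nA₁ x + j))
    (fun a => ¬ (V.Edge x r u v b ∧ a = b)) hA₂ (u := v) (p := q) (by omega)
  rw [Finset.sum_range_add]
  rw [← e₁, ← e₂]
  congr 1
  · refine Finset.sum_congr rfl fun j hj => ?_
    rw [Finset.mem_range] at hj
    have : V.ans₁ x (j % V.nA₁ x) = V.ans₁ x j := by simp [ans₁]
    rw [this]
    refine if_congr ?_ rfl rfl
    simp only [Entry]
    constructor
    · rintro (h | h)
      · exact h
      · omega
    · exact Or.inl
  · refine Finset.sum_congr rfl fun j hj => ?_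
    refine if_congr ?_ rfl rfl
    simp only [Entry, Nat.add_sub_cancel_left]
    constructor
    · rintro (h | h)
      · have := Nat.div_le_div_right (c := V.nA₁ x) (Nat.le_add_right (H * V.nA₁ x) j)
        rw [Nat.mul_div_cancel _ hA₁] at this
        omega
      · exact h.2
    · exact fun h => Or.inr ⟨Nat.le_add_right _ _, h⟩

open Classical in
-- The vector is extended to a function on all naturals so that the blocks of columns can be handled
-- by arithmetic on indices.
theorem mulVec_matrix {m p : ℕ} (y : Fin p → ℝ) (i : Fin m) (X : ℕ → ℝ)
    (hX : ∀ j : Fin p, X j = y j) {r : Fin (V.nR x)} {u v b : ℕ}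
    (hi : ∀ j, V.EntryAt x H i j ↔ V.Entry x H r u v b j) :
    (toReal (V.matrix x H m p)).mulVec y i =
      ∑ j ∈ Finset.range p, if V.Entry x H r u v b j then X j else 0 := by
  rw [Matrix.mulVec, dotProduct, ← Fin.sum_univ_eq_sum_range
    (fun j => if V.Entry x H r u v b j then X j else 0)]
  refine Finset.sum_congr rfl fun j _ => ?_
  simp only [toReal, Matrix.map_apply, matrix, decide_eq_true_eq, hX, hi]
  split_ifs <;> simp

/-! ### Completeness -/

/-- Accepted strategies yield an exact sparse solution. -/
theorem hasExactSparse_matrix (hf : V.Functionality) (hH : 0 < H) {m p : ℕ}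
    (hp : H * V.nA₁ x + H * V.nA₂ x ≤ p)
    {P₁ : Fin (V.nQ₁ x) → Fin (V.nA₁ x)} {P₂ : Fin (V.nQ₂ x) → Fin (V.nA₂ x)}
    (hV : V.value x P₁ P₂ = 1) : HasExactSparse (V.matrix x H m p) (2 * H) := by
  classical
  have hA₁ := V.nA₁_pos x
  have hA₂ := V.nA₂_pos x
  have hacc : ∀ r, V.accept x r (P₁ (V.query₁ x r)) (P₂ (V.query₂ x r)) = true := by
    have hR : (V.nR x : ℝ) ≠ 0 := by exact_mod_cast (V.nR_pos x).ne'
    rw [value, div_eq_one_iff_eq hR, Nat.cast_inj] at hV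
    have := (Finset.card_eq_iff_eq_univ _).1 (hV.trans (Fintype.card_fin _).symm)
    intro r
    have hr := Finset.mem_univ r
    rw [← this, Finset.mem_filter] at hr
    exact hr.2
  let A₁ : ℕ → ℕ := fun u => P₁ ⟨u % V.nQ₁ x, Nat.mod_lt _ (V.nQ₁_pos x)⟩
  let A₂ : ℕ → ℕ := fun v => P₂ ⟨v % V.nQ₂ x, Nat.mod_lt _ (V.nQ₂_pos x)⟩
  have hA₁l : ∀ u, A₁ u < V.nA₁ x := fun u => (P₁ _).2
  have hA₂l : ∀ u, A₂ u < V.nA₂ x := fun u => (P₂ _).2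
  let S : Finset ℕ := (Finset.range H).image (fun u => u * V.nA₁ x + A₁ u) ∪
    (Finset.range H).image (fun v => H * V.nA₁ x + (v * V.nA₂ x + A₂ v))
  have hSc : S.card ≤ 2 * H := by
    refine (Finset.card_union_le _ _).trans ?_
    have h1 := Finset.card_image_le (s := Finset.range H) (f := fun u => u * V.nA₁ x + A₁ u)
    have h2 := Finset.card_image_le (s := Finset.range H)
      (f := fun v => H * V.nA₁ x + (v * V.nA₂ x + A₂ v))
    rw [Finset.card_range] at h1 h2
    omega
  have hlt : ∀ {n u a : ℕ}, u < H → a < n → u * n + a < H * n := fun {n u a} hu ha => by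
    have := Nat.mul_le_mul_right n (Nat.succ_le_of_lt hu)
    rw [Nat.succ_mul] at this
    omega
  have huniq : ∀ {n u u' a a' : ℕ}, a < n → a' < n → u * n + a = u' * n + a' → u = u' ∧ a = a' := by
    intro n u u' a a' ha ha' h
    have h1 := congrArg (· / n) h
    have h2 := congrArg (· % n) h
    have hn : 0 < n := by omega
    simp only [Nat.add_comm (_ * n), Nat.add_mul_div_right _ _ hn, Nat.add_mul_mod_self_right,
      Nat.div_eq_of_lt ha, Nat.div_eq_of_lt ha', Nat.mod_eq_of_lt ha, Nat.mod_eq_of_lt ha'] at h1 h2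
    omega
  have hS₁ : ∀ u < H, ∀ a < V.nA₁ x, (u * V.nA₁ x + a ∈ S ↔ a = A₁ u) := by
    intro u hu a ha
    simp only [S, Finset.mem_union, Finset.mem_image, Finset.mem_range]
    constructor
    · rintro (⟨u', hu', h⟩ | ⟨v, hv, h⟩)
      · obtain ⟨rfl, rfl⟩ := huniq (hA₁l _) ha h
        rfl
      · have := hlt hu ha
        omega
    · rintro rfl
      exact Or.inl ⟨u, hu, rfl⟩
  have hS₂ : ∀ v < H, ∀ a < V.nA₂ x, (H * V.nA₁ x + (v * V.nA₂ x + a) ∈ S ↔ a = A₂ v) := by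
    intro v hv a ha
    simp only [S, Finset.mem_union, Finset.mem_image, Finset.mem_range]
    constructor
    · rintro (⟨u', hu', h⟩ | ⟨v', hv', h⟩)
      · have := hlt hu' (hA₁l u')
        omega
      · obtain ⟨rfl, rfl⟩ := huniq (hA₂l _) ha (Nat.add_left_cancel h)
        rfl
    · rintro rfl
      exact Or.inr ⟨v, hv, rfl⟩
  refine ⟨fun j => if (j : ℕ) ∈ S then 1 else 0, fun j => ?_, ?_, ?_⟩
  · by_cases h : (j : ℕ) ∈ S <;> simp [h]
  · ext1 i
    rw [mulVec_matrix _ i (fun j => if j ∈ S then 1 else 0) (fun _ => rfl) fun _ => Iff.rfl]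
    have hu : (i : ℕ) / V.nR x % H < H := Nat.mod_lt _ hH
    have hv : (i : ℕ) / V.nR x / H % H < H := Nat.mod_lt _ hH
    rw [sum_entry hu hv hp]
    generalize (i : ℕ) / V.nR x % H = u at *
    generalize (i : ℕ) / V.nR x / H % H = v at *
    generalize (i : ℕ) / V.nR x / H / H % (V.nA₂ x + 1) = b
    generalize V.rand x i = r
    have e₁ : ∀ a ∈ Finset.range (V.nA₁ x), (if V.Edge x r u v b ∧
        V.accept x r (V.ans₁ x a) (V.ans₂ x b) = true then
        (if u * V.nA₁ x + a ∈ S then (1 : ℝ) else 0) else 0) = if a = A₁ u then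
        (if V.Edge x r u v b ∧ V.accept x r (V.ans₁ x (A₁ u)) (V.ans₂ x b) = true
          then 1 else 0) else 0 := by
      intro a ha
      rw [Finset.mem_range] at ha
      by_cases h : a = A₁ u
      · rw [if_pos ((hS₁ u hu a ha).2 h), if_pos h, h]
      · simp [hS₁ u hu a ha, h]
    have e₂ : ∀ a ∈ Finset.range (V.nA₂ x), (if ¬ (V.Edge x r u v b ∧ a = b) then
        (if H * V.nA₁ x + (v * V.nA₂ x + a) ∈ S then (1 : ℝ) else 0) else 0) = if a = A₂ v then
        (if ¬ (V.Edge x r u v b ∧ A₂ v = b) then 1 else 0) else 0 := by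
      intro a ha
      rw [Finset.mem_range] at ha
      by_cases h : a = A₂ v
      · rw [if_pos ((hS₂ v hv a ha).2 h), if_pos h, h]
      · simp [hS₂ v hv a ha, h]
    rw [Finset.sum_congr rfl e₁, Finset.sum_congr rfl e₂, Finset.sum_ite_eq', Finset.sum_ite_eq',
      if_pos (Finset.mem_range.2 (hA₁l u)), if_pos (Finset.mem_range.2 (hA₂l v))]
    by_cases hE : V.Edge x r u v b
    · have hr := hacc r
      have h1 : V.ans₁ x (A₁ u) = P₁ (V.query₁ x r) := by
        ext
        simp only [ans₁, A₁, hE.1.1]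
        exact Nat.mod_eq_of_lt (P₁ _).2
      have h2 : A₂ v = P₂ (V.query₂ x r) := by
        simp only [A₂, hE.1.2]
      -- Functionality enters here: the intended a₁ is accepted with no second answer other than the
      -- intended one. So if b is the intended answer the first part of the row gives 1 and the
      -- second 0, and otherwise the reverse.
      have h3 : V.accept x r (V.ans₁ x (A₁ u)) (V.ans₂ x b) = true ↔ A₂ v = b := by
        rw [h1, h2]
        constructor
        · intro h
          have := hf x r _ _ _ hr h
          rw [this]
          exact Nat.mod_eq_of_lt hE.2
        · intro h
          have : V.ans₂ x b = P₂ (V.query₂ x r) := by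
            ext
            simp only [ans₂, ← h]
            exact Nat.mod_eq_of_lt (P₂ _).2
          rwa [this]
      by_cases hb : A₂ v = b
      · simp [hE, h3, hb]
      · simp [hE, h3, hb]
    · simp [hE]
  · refine le_trans ?_ hSc
    rw [hammingNorm]
    refine Finset.card_le_card_of_injOn (fun j => (j : ℕ)) (fun j hj => ?_)
      (fun _ _ _ _ h => Fin.ext h)
    simpa using hj

/-! ### Soundness -/

/-- Every row is repeated often. -/
theorem exists_rows (hR : V.nR x ≤ H) (hA : V.nA₂ x + 1 ≤ H) (r : Fin (V.nR x)) {u v b : ℕ}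
    (hu : u < H) (hv : v < H) (hb : b < V.nA₂ x + 1) (M : ℕ) :
    ∃ e : Fin M → Fin (H * (H * (H * (H * M)))), Function.Injective e ∧
      ∀ t j, V.EntryAt x H (e t) j ↔ V.Entry x H r u v b j := by
  have hstep : ∀ {n y k z : ℕ}, k < n → n ≤ H → y < z → k + n * y < H * z := fun {n y k z} hk hn hy =>
    calc k + n * y < n + n * y := by omega
      _ = n * (y + 1) := by ring
      _ ≤ H * z := Nat.mul_le_mul hn hy
  have hRp := V.nR_pos x
  -- The row number has mixed-radix digits r, u, v, b followed by an unconstrained t. Decoding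
  -- ignores t, and each of the four radices is at most H.
  refine ⟨fun t => ⟨r + V.nR x * (u + H * (v + H * (b + (V.nA₂ x + 1) * t))),
    hstep r.2 hR (hstep hu le_rfl (hstep hv le_rfl (hstep hb hA t.2)))⟩, ?_, ?_⟩
  · intro t t' h
    simp only [Fin.mk.injEq, Nat.add_left_cancel_iff] at h
    have hH : 0 < H := by omega
    have h1 := Nat.eq_of_mul_eq_mul_left hRp h
    have h2 := Nat.eq_of_mul_eq_mul_left hH (Nat.add_left_cancel h1)
    have h3 := Nat.eq_of_mul_eq_mul_left hH (Nat.add_left_cancel h2)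
    exact Fin.ext (Nat.eq_of_mul_eq_mul_left (Nat.succ_pos _) (Nat.add_left_cancel h3))
  · intro t j
    have hH : 0 < H := by omega
    have e1 : V.rand x (r + V.nR x * (u + H * (v + H * (b + (V.nA₂ x + 1) * t)))) = r := by
      ext
      simp only [rand, Nat.add_mul_mod_self_left]
      exact Nat.mod_eq_of_lt r.2
    simp only [EntryAt, e1, Nat.add_mul_div_left _ _ hRp, Nat.div_eq_of_lt r.2, Nat.zero_add,
      Nat.add_mul_mod_self_left, Nat.mod_eq_of_lt hu, Nat.add_mul_div_left _ _ hH,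
      Nat.div_eq_of_lt hu, Nat.mod_eq_of_lt hv, Nat.div_eq_of_lt hv, Nat.mod_eq_of_lt hb]

open Classical in
-- As p = H², p⁵ = H⁴·p³, so the row has p³ copies. Their equal squared errors add up to at most p,
-- hence each is at most 1/p².
theorem row_error (hR : V.nR x ≤ H) (hA : V.nA₂ x + 1 ≤ H) {p : ℕ} (hp : p = H ^ 2)
    (y : Fin p → ℝ) (X : ℕ → ℝ) (hX : ∀ j : Fin p, X j = y j)
    (hy : ‖WithLp.toLp 2 ((toReal (V.matrix x H (p ^ 5) p)).mulVec y - 1)‖ ^ 2 ≤ p)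
    (r : Fin (V.nR x)) {u v b : ℕ} (hu : u < H) (hv : v < H) (hb : b < V.nA₂ x + 1) :
    |(∑ j ∈ Finset.range p, if V.Entry x H r u v b j then X j else 0) - 1| ≤ 1 / p := by
  obtain ⟨e, he, hrow⟩ := exists_rows hR hA r hu hv hb (p ^ 3)
  have hpp : (0 : ℝ) < p := by
    have : 0 < p := by rw [hp]; exact pow_pos (by omega) 2
    exact_mod_cast this
  have hm : H * (H * (H * (H * p ^ 3))) = p ^ 5 := by rw [hp]; ring
  set E := (∑ j ∈ Finset.range p, if V.Entry x H r u v b j then X j else 0) - 1 with hE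
  rw [EuclideanSpace.norm_sq_eq] at hy
  have h1 : ∑ _t : Fin (p ^ 3), E ^ 2 ≤ p := by
    refine le_trans ?_ hy
    have himg := Finset.sum_image (s := Finset.univ) (g := fun t => Fin.cast hm (e t))
      (f := fun i => ‖(WithLp.toLp 2 ((toReal (V.matrix x H (p ^ 5) p)).mulVec y - 1)) i‖ ^ 2)
      (fun a _ b _ h => he (Fin.cast_injective hm h))
    refine le_trans (le_of_eq (Eq.trans ?_ himg.symm)) ?_
    rotate_left
    · exact Finset.sum_le_sum_of_subset_of_nonneg (Finset.subset_univ _)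
        fun _ _ _ => by positivity
    · refine Finset.sum_congr rfl fun t _ => ?_
      simp only [Real.norm_eq_abs, sq_abs, Pi.sub_apply, Pi.one_apply]
      rw [mulVec_matrix y (Fin.cast hm (e t)) X hX (hrow t), hE]
  simp only [Finset.sum_const, Finset.card_univ, Fintype.card_fin, nsmul_eq_mul] at h1
  push_cast at h1
  refine abs_le_of_sq_le_sq ?_ (by positivity)
  rw [div_pow, one_pow, le_div_iff₀ (by positivity)]
  have : p * (E ^ 2 * (p : ℝ) ^ 2) ≤ p * 1 := by linarith [h1, show p * (E ^ 2 * (p : ℝ) ^ 2) = p ^ 3 * E ^ 2 by ring]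
  exact le_of_mul_le_mul_left this hpp

open Classical in
/-- An approximate solution contains accepted answers to every pair of questions. -/
theorem exists_accepted (hA : V.nA₂ x + 1 ≤ H) {p : ℕ} (hp : p = H ^ 2)
    (hpA : H * V.nA₁ x + H * V.nA₂ x ≤ p) (X : ℕ → ℝ) {r : Fin (V.nR x)} {u v : ℕ}
    (hu : u < H) (hv : v < H) (hq₁ : u % V.nQ₁ x = V.query₁ x r) (hq₂ : v % V.nQ₂ x = V.query₂ x r)
    (herr : ∀ b < V.nA₂ x + 1,
      |(∑ j ∈ Finset.range p, if V.Entry x H r u v b j then X j else 0) - 1| ≤ 1 / p) :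
    ∃ a₁ : Fin (V.nA₁ x), X (u * V.nA₁ x + a₁) ≠ 0 ∧ ∃ a₂ : Fin (V.nA₂ x),
      X (H * V.nA₁ x + (v * V.nA₂ x + a₂)) ≠ 0 ∧ V.accept x r a₁ a₂ = true := by
  by_contra! hcon
  set δ : ℝ := 1 / p with hδ
  have hH0 : (0 : ℝ) < H := by exact_mod_cast (Nat.succ_pos _).trans_le hA
  have hA' : (V.nA₂ x : ℝ) + 1 ≤ H := by exact_mod_cast hA
  have hA₂ : (1 : ℝ) ≤ V.nA₂ x := by exact_mod_cast V.nA₂_pos x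
  have hδ' : δ * H ^ 2 = 1 := by
    rw [hδ, hp]
    push_cast
    field_simp
  set T := ∑ a ∈ Finset.range (V.nA₂ x), X (H * V.nA₁ x + (v * V.nA₂ x + a)) with hT
  have hT1 : |T - 1| ≤ δ := by
    -- The extra value b = |A₂| is not an answer, so this row is the normalization of the block at
    -- v.
    have h := herr (V.nA₂ x) (Nat.lt_succ_self _)
    rw [sum_entry hu hv hpA] at h
    have hE : ¬ V.Edge x r u v (V.nA₂ x) := fun h => lt_irrefl _ h.2
    simpa [hE] using h
  -- For b in the support, no answer accepted with b has weight at u, so row b reduces to T minus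
  -- the weight of b. Both this and T are within δ of 1.
  have hb : ∀ b ∈ Finset.range (V.nA₂ x), X (H * V.nA₁ x + (v * V.nA₂ x + b)) ≤ 2 * δ := by
    intro b hbA
    rw [Finset.mem_range] at hbA
    rw [abs_le] at hT1
    by_cases hb0 : X (H * V.nA₁ x + (v * V.nA₂ x + b)) = 0
    · rw [hb0]; nlinarith [hT1.1, hT1.2]
    have h := herr b (by omega)
    rw [sum_entry hu hv hpA] at h
    have hE : V.Edge x r u v b := ⟨⟨hq₁, hq₂⟩, hbA⟩
    have h1 : (∑ a ∈ Finset.range (V.nA₁ x), if V.Edge x r u v b ∧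
        V.accept x r (V.ans₁ x a) (V.ans₂ x b) = true then X (u * V.nA₁ x + a) else 0) = 0 := by
      refine Finset.sum_eq_zero fun a ha => ?_
      rw [Finset.mem_range] at ha
      split_ifs with hacc
      · by_contra ha0
        have ea : V.ans₁ x a = ⟨a, ha⟩ := Fin.ext (Nat.mod_eq_of_lt ha)
        have eb : V.ans₂ x b = ⟨b, hbA⟩ := Fin.ext (Nat.mod_eq_of_lt hbA)
        refine hcon ⟨a, ha⟩ ha0 ⟨b, hbA⟩ hb0 ?_
        rw [← ea, ← eb]
        exact hacc.2
      · rfl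
    have h2 : (∑ a ∈ Finset.range (V.nA₂ x), if ¬ (V.Edge x r u v b ∧ a = b) then
        X (H * V.nA₁ x + (v * V.nA₂ x + a)) else 0) =
        T - X (H * V.nA₁ x + (v * V.nA₂ x + b)) := by
      rw [hT, ← Finset.add_sum_erase (Finset.range (V.nA₂ x))
          (fun a => X (H * V.nA₁ x + (v * V.nA₂ x + a))) (Finset.mem_range.2 hbA),
        add_sub_cancel_left, ← Finset.add_sum_erase _ _ (Finset.mem_range.2 hbA)]
      simp only [hE, true_and, not_true_eq_false, if_false, zero_add]
      refine Finset.sum_congr rfl fun a ha => ?_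
      rw [if_pos (Finset.ne_of_mem_erase ha)]
    rw [h1, h2, abs_le] at h
    linarith [h.1, hT1.2]
  have hTle := Finset.sum_le_card_nsmul _ _ _ hb
  rw [Finset.card_range, nsmul_eq_mul, ← hT] at hTle
  rw [abs_le] at hT1
  have hδ0 : 0 < δ := by
    by_contra hneg
    nlinarith [sq_nonneg (H : ℝ)]
  have : (V.nA₂ x : ℝ) * (2 * δ) ≤ (H - 1) * (2 * δ) :=
    mul_le_mul_of_nonneg_right (by linarith) (by linarith)
  -- Here 1 - δ ≤ T ≤ 2(H - 1)δ, while δH² = 1 gives 1 - δ - 2(H - 1)δ = δ(H - 1)² > 0, because H ≥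
  -- 2.
  nlinarith [hT1.1, mul_pos hδ0 (show (0 : ℝ) < (H - 1) ^ 2 by nlinarith)]

open Classical in
/-- A sparse approximate solution yields good strategies. -/
theorem exists_value_ge_of_approx (hV : V.Uniformity) (hR : V.nR x ≤ H) (hQ₁ : V.nQ₁ x ≤ H)
    (hQ₂ : V.nQ₂ x ≤ H) (hA : V.nA₁ x + V.nA₂ x ≤ H) {m p : ℕ} (hm : m = p ^ 5)
    (hp : p = H ^ 2) (y : Fin p → ℝ)
    (hy : ‖WithLp.toLp 2 ((toReal (V.matrix x H m p)).mulVec y - 1)‖ ^ 2 ≤ p)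
    {K : ℝ} (hK : 0 < K) (hyK : (hammingNorm y : ℝ) ≤ K * H) :
    ∃ P₁ P₂, 1 / K ^ 2 ≤ V.value x P₁ P₂ := by
  subst hm
  have hA₁0 := V.nA₁_pos x
  have hA₂0 := V.nA₂_pos x
  have hA' : V.nA₂ x + 1 ≤ H := by omega
  have hpA : H * V.nA₁ x + H * V.nA₂ x ≤ p := by
    rw [hp, ← Nat.mul_add, sq]
    exact Nat.mul_le_mul_left _ hA
  let X : ℕ → ℝ := fun j => if h : j < p then y ⟨j, h⟩ else 0
  have hX : ∀ j : Fin p, X j = y j := fun j => by simp [X]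
  let N : ℕ → ℕ := fun j => if X j ≠ 0 then 1 else 0
  have hN : ∑ j ∈ Finset.range p, N j = hammingNorm y := by
    rw [hammingNorm, Finset.card_filter, ← Fin.sum_univ_eq_sum_range N]
    exact Finset.sum_congr rfl fun j _ => by simp [N, hX]
  let L₁ : ℕ → ℕ := fun u => ∑ a ∈ Finset.range (V.nA₁ x), N (u * V.nA₁ x + a)
  let L₂ : ℕ → ℕ := fun v => ∑ a ∈ Finset.range (V.nA₂ x), N (H * V.nA₁ x + (v * V.nA₂ x + a))
  have hL : ∑ u ∈ Finset.range H, L₁ u + ∑ v ∈ Finset.range H, L₂ v ≤ hammingNorm y := by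
    rw [← hN, sum_range_blocks N, sum_range_blocks (fun j => N (H * V.nA₁ x + j)),
      ← Finset.sum_range_add]
    exact Finset.sum_le_sum_of_subset (Finset.range_subset_range.2 hpA)
  -- A block of |Q₁| consecutive copies, starting at a multiple of |Q₁|, contains each question
  -- once, so a light block provides one list per question.
  obtain ⟨t₁, ht₁, hs₁⟩ := exists_block_le L₁ (V.nQ₁_pos x) hQ₁
  obtain ⟨t₂, ht₂, hs₂⟩ := exists_block_le L₂ (V.nQ₂_pos x) hQ₂
  have hblk : ∀ {n t q : ℕ}, q < n → t < H / n → t * n + q < H := fun {n t q} hq ht => by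
    have h1 := Nat.mul_le_mul_right n (Nat.succ_le_of_lt ht)
    have h2 := Nat.div_mul_le_self H n
    rw [Nat.succ_mul] at h1
    omega
  let Λ₁ : Fin (V.nQ₁ x) → Finset (Fin (V.nA₁ x)) := fun q =>
    Finset.univ.filter fun a => X ((t₁ * V.nQ₁ x + q) * V.nA₁ x + a) ≠ 0
  let Λ₂ : Fin (V.nQ₂ x) → Finset (Fin (V.nA₂ x)) := fun q =>
    Finset.univ.filter fun a => X (H * V.nA₁ x + ((t₂ * V.nQ₂ x + q) * V.nA₂ x + a)) ≠ 0
  have hΛ₁ : ∑ q, (Λ₁ q).card = ∑ q ∈ Finset.range (V.nQ₁ x), L₁ (t₁ * V.nQ₁ x + q) := by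
    rw [← Fin.sum_univ_eq_sum_range (fun q => L₁ (t₁ * V.nQ₁ x + q))]
    refine Finset.sum_congr rfl fun q _ => ?_
    rw [Finset.card_filter]
    exact Fin.sum_univ_eq_sum_range (fun a => N ((t₁ * V.nQ₁ x + q) * V.nA₁ x + a)) _
  have hΛ₂ : ∑ q, (Λ₂ q).card = ∑ q ∈ Finset.range (V.nQ₂ x), L₂ (t₂ * V.nQ₂ x + q) := by
    rw [← Fin.sum_univ_eq_sum_range (fun q => L₂ (t₂ * V.nQ₂ x + q))]
    refine Finset.sum_congr rfl fun q _ => ?_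
    rw [Finset.card_filter]
    exact Fin.sum_univ_eq_sum_range
      (fun a => N (H * V.nA₁ x + ((t₂ * V.nQ₂ x + q) * V.nA₂ x + a))) _
  rw [← hΛ₁] at hs₁
  rw [← hΛ₂] at hs₂
  have hH0 : (0 : ℝ) < H := by exact_mod_cast (Nat.succ_pos _).trans_le hA'
  have havg : ∀ {n c S : ℕ}, 0 < n → n ≤ H → (H / n) * c ≤ S → (c : ℝ) / n ≤ 2 * S / H := by
    intro n c S hn hnH h
    rw [div_le_div_iff₀ (by exact_mod_cast hn) hH0]
    -- Complete blocks cover at least half of the copies, so discarding the remainder costs a factor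
    -- 2. This makes the bound on the combined average a = 2K, and 4/a² = 1/K².
    have h1 : H ≤ 2 * (n * (H / n)) := by
      have h2 := Nat.div_add_mod H n
      have h3 := Nat.mod_lt H hn
      have h4 : n * 1 ≤ n * (H / n) := Nat.mul_le_mul_left _ (Nat.div_pos hnH hn)
      omega
    have h5 : c * H ≤ 2 * S * n := by
      calc c * H ≤ c * (2 * (n * (H / n))) := Nat.mul_le_mul_left _ h1
        _ = 2 * ((H / n) * c) * n := by ring
        _ ≤ 2 * S * n := by gcongr
    exact_mod_cast h5
  have h₁ := havg (V.nQ₁_pos x) hQ₁ hs₁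
  have h₂ := havg (V.nQ₂_pos x) hQ₂ hs₂
  have hLr : ((∑ u ∈ Finset.range H, L₁ u : ℕ) : ℝ) + (∑ v ∈ Finset.range H, L₂ v : ℕ) ≤ K * H :=
    le_trans (by exact_mod_cast hL) hyK
  obtain ⟨P₁, P₂, h⟩ := exists_value_ge hV x Λ₁ Λ₂ (fun r => by
    have hu := hblk (V.query₁ x r).2 ht₁
    have hv := hblk (V.query₂ x r).2 ht₂
    obtain ⟨a₁, h1, a₂, h2, h3⟩ := exists_accepted hA' hp hpA X (r := r) hu hv
      (by rw [Nat.add_comm, Nat.add_mul_mod_self_right]; exact Nat.mod_eq_of_lt (V.query₁ x r).2)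
      (by rw [Nat.add_comm, Nat.add_mul_mod_self_right]; exact Nat.mod_eq_of_lt (V.query₂ x r).2)
      fun b hb => row_error hR hA' hp y X hX hy r hu hv hb
    exact ⟨a₁, by simpa [Λ₁] using h1, a₂, by simpa [Λ₂] using h2, h3⟩) (a := 2 * K)
    (by positivity) (by
      push_cast at h₁ h₂ hLr
      refine (add_le_add h₁ h₂).trans ?_
      rw [← add_div, div_le_iff₀ hH0]
      linarith)
  refine ⟨P₁, P₂, le_trans (le_of_eq ?_) h⟩
  field_simp
  norm_num

end Verifier
section

/-! ## The matrix is computable in polynomial time -/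

variable {α : Type} {n : ℕ} {inp : α → List (List Bool)}

theorem Verifier.Efficient.decides_entryAt {V : Verifier} (hV : V.Efficient) {X : α → List Bool}
    {H i j : α → ℕ} (hX : Clean n inp X) (hH : Computes n inp H) (hpos : ∀ a, 0 < H a)
    (hi : Computes n inp i) (hj : Computes n inp j) :
    Decides n inp (fun a => V.EntryAt (X a) (H a) (i a) (j a)) := by
  obtain ⟨h1, h2, h3, h4, h5, h6, h7, h8⟩ := hV
  have hR : Computes n inp (fun a => V.nR (X a)) := Clean.comp₁ h1 hX
  have hQ₁ : Computes n inp (fun a => V.nQ₁ (X a)) := Clean.comp₁ h2 hX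
  have hQ₂ : Computes n inp (fun a => V.nQ₂ (X a)) := Clean.comp₁ h3 hX
  have hA₁ : Computes n inp (fun a => V.nA₁ (X a)) := Clean.comp₁ h4 hX
  have hA₂ : Computes n inp (fun a => V.nA₂ (X a)) := Clean.comp₁ h5 hX
  have hr : Computes n inp (fun a => V.rand (X a) (i a)) := hi.mod hR fun a => V.nR_pos _
  have hi₁ := hi.div hR fun a => V.nR_pos _
  have hu := hi₁.mod hH hpos
  have hi₂ := hi₁.div hH hpos
  have hv := hi₂.mod hH hpos
  have hi₃ := hi₂.div hH hpos
  have hb := hi₃.mod (hA₂.add (Computes.const hX.1 1)) fun a => Nat.succ_pos _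
  have ha₁ : Computes n inp (fun a => V.ans₁ (X a) (j a)) := hj.mod hA₁ fun a => V.nA₁_pos _
  have ha₂ : Computes n inp (fun a => V.ans₂ (X a)
      (i a / V.nR (X a) / H a / H a % (V.nA₂ (X a) + 1))) := hb.mod hA₂ fun a => V.nA₂_pos _
  have hq₁ : Computes n inp (fun a => V.query₁ (X a) (V.rand (X a) (i a))) :=
    Clean.comp hX.1 [X, fun a => unary (V.rand (X a) (i a))] (by simp [hX, hr])
      (h6.comap fun a => ⟨X a, V.rand (X a) (i a)⟩)
  have hq₂ : Computes n inp (fun a => V.query₂ (X a) (V.rand (X a) (i a))) :=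
    Clean.comp hX.1 [X, fun a => unary (V.rand (X a) (i a))] (by simp [hX, hr])
      (h7.comap fun a => ⟨X a, V.rand (X a) (i a)⟩)
  have hacc : Clean n inp (fun a => [V.accept (X a) (V.rand (X a) (i a)) (V.ans₁ (X a) (j a))
      (V.ans₂ (X a) (i a / V.nR (X a) / H a / H a % (V.nA₂ (X a) + 1)))]) :=
    Clean.comp hX.1 [X, fun a => unary (V.rand (X a) (i a)), fun a => unary (V.ans₁ (X a) (j a)),
      fun a => unary (V.ans₂ (X a) (i a / V.nR (X a) / H a / H a % (V.nA₂ (X a) + 1)))]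
      (by simp [hX, hr, ha₁, ha₂])
      (h8.comap fun a => ⟨X a, V.rand (X a) (i a), V.ans₁ (X a) (j a),
        V.ans₂ (X a) (i a / V.nR (X a) / H a / H a % (V.nA₂ (X a) + 1))⟩)
  -- The condition b < |A₂| is tested as b + 1 ≤ |A₂|.
  have hE := (((hu.mod hQ₁ fun a => V.nQ₁_pos _).decides_eq hq₁).and
    ((hv.mod hQ₂ fun a => V.nQ₂_pos _).decides_eq hq₂)).and
    ((Computes.add hb (Computes.const hX.1 1)).decides_le hA₂)
  have hHA := hH.mul hA₁
  have hj' := hj.sub hHA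
  exact (((hj.div hA₁ fun a => V.nA₁_pos _).decides_eq hu).and (hE.and hacc.decides_bit)).or
    ((hHA.decides_le hj).and (((hj'.div hA₂ fun a => V.nA₂_pos _).decides_eq hv).and
      (hE.and ((hj'.mod hA₂ fun a => V.nA₂_pos _).decides_eq hb)).not))

theorem flatten_ofFn {m : ℕ} (g : ℕ → List Bool) :
    (List.ofFn fun i : Fin m => g i).flatten = (List.range m).flatMap g := by
  rw [List.flatMap_def]
  congr 1
  exact List.ext_getElem (by simp) fun i _ _ => by simp

theorem ofFn_eq_flatMap {m : ℕ} (g : ℕ → Bool) :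
    (List.ofFn fun i : Fin m => g i) = (List.range m).flatMap fun i => [g i] := by
  rw [← List.map_eq_flatMap]
  exact List.ext_getElem (by simp) fun i _ _ => by simp

theorem length_encodeMatrix {m p : ℕ} (B : Matrix (Fin m) (Fin p) Bool) :
    (encodeMatrix B).length = m + 1 + p + 1 + m * p := by
  simp [encodeMatrix, unary, List.length_flatten, List.map_ofFn, Function.comp_def]
  ring

theorem Verifier.Efficient.clean_encodeMatrix {V : Verifier} (hV : V.Efficient) {X : α → List Bool}
    {H m p : α → ℕ} (hX : Clean n inp X) (hH : Computes n inp H) (hpos : ∀ a, 0 < H a)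
    (hm : Computes n inp m) (hp : Computes n inp p) :
    Clean n inp (fun a => encodeMatrix (V.matrix (X a) (H a) (m a) (p a))) := by
  classical
  have hrow := Clean.flatMap (g := fun (b : α × ℕ) j => [decide (V.EntryAt (X b.1) (H b.1) b.2 j)])
    (Clean.ext_left hp) (hV.decides_entryAt (X := fun b => X b.1.1) (H := fun b => H b.1.1)
      (i := fun b : (α × ℕ) × ℕ => b.1.2) (j := fun b => b.2)
      (Clean.ext_left (Clean.ext_left hX)) (Clean.ext_left (Clean.ext_left hH))
      (fun _ => hpos _) (Clean.ext_left (Clean.ext_right hX.1))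
      (Clean.ext_right (Clean.ext_right hX.1).1)).bit
  have hbits := Clean.flatMap (g := fun a i => (List.range (p a)).flatMap fun j =>
    [decide (V.EntryAt (X a) (H a) i j)]) hm hrow
  have h0 := Clean.const hX.1 [false]
  convert (((Clean.append hm h0).append hp).append h0).append hbits using 2 with a
  rw [encodeMatrix, ← flatten_ofFn]
  congr 3
  ext1 i
  rw [← ofFn_eq_flatMap]
  rfl

end

/-! ## Reductions -/

theorem accepts_iff {P : Prog} {x w : List Bool} {t : ℕ} {s : Regs}
    (h : Exec P (load [x, w]) t s) : Accepts P x w ↔ s 0 = [true] := by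
  constructor
  · rintro ⟨t', s', h', hs⟩
    rw [(h.det h').2, hs]
  · exact fun hs => ⟨t, s, h, hs⟩

theorem acceptProb_congr {P P' : Prog} {x x' : List Bool} {n n' : ℕ} (hn : n = n')
    (h : ∀ w : List Bool, w.length = n → (Accepts P x w ↔ Accepts P' x' w)) :
    acceptProb P n x = acceptProb P' n' x' := by
  subst hn
  rw [acceptProb, acceptProb]
  congr 3
  ext w
  simp only [Finset.mem_filter, Finset.mem_univ, true_and]
  exact h _ (by simp)

theorem acceptProb_of_forall {P : Prog} {x : List Bool} {n : ℕ}
    (h : ∀ w : List Bool, w.length = n → Accepts P x w) : acceptProb P n x = 1 := by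
  classical
  rw [acceptProb, Finset.filter_true_of_mem fun w _ => h (List.ofFn w) (by simp)]
  simp

theorem acceptProb_of_forall_not {P : Prog} {x : List Bool} {n : ℕ}
    (h : ∀ w : List Bool, w.length = n → ¬ Accepts P x w) : acceptProb P n x = 0 := by
  classical
  rw [acceptProb, Finset.filter_false_of_mem fun w _ => h (List.ofFn w) (by simp)]
  simp

open Classical in
/-- A reduction that is correct on all sufficiently long inputs transfers BPP algorithms. -/
theorem BPPDistinguishable.of_reduction {L yes no : Set (List Bool)}
    (h : BPPDistinguishable yes no) {e : List Bool → List Bool}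
    (he : Clean 1 (fun x => [x]) e) (ℓ : Polynomial ℕ)
    (hℓ : ∀ x, (e x).length = ℓ.eval x.length) (N₀ : ℕ)
    (hyes : ∀ x ∈ L, N₀ ≤ x.length → e x ∈ yes) (hno : ∀ x ∉ L, N₀ ≤ x.length → e x ∈ no) :
    BPPDistinguishable L Lᶜ := by
  obtain ⟨P, ρ, τ, hP, hPyes, hPno⟩ := h
  set ρ' := ρ.comp ℓ with hρ'
  have hρ : ∀ x, ρ'.eval x.length = ρ.eval (e x).length := fun x => by
    rw [hρ', Polynomial.eval_comp, hℓ]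
  -- The distinguisher need not halt outside the promise, so its output is made total with a default
  -- value; determinism makes it the real output wherever there is one.
  let o : List Bool → List Bool → List Bool := fun y w =>
    if h : ∃ t s, Exec P (load [y, w]) t s then h.choose_spec.choose 0 else []
  have ho : ∀ {y w t s}, Exec P (load [y, w]) t s → o y w = s 0 := fun {y w t s} h => by
    have hex : ∃ t s, Exec P (load [y, w]) t s := ⟨t, s, h⟩
    simp only [o, dif_pos hex]
    rw [(hex.choose_spec.choose_spec.det h).2]
  have hhalt : ∀ y ∈ yes ∪ no, ∀ w : List Bool, w.length = ρ.eval y.length →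
      ∃ t s, Exec P (load [y, w]) t s ∧ t ≤ τ.eval y.length := by
    intro y hy w hw
    obtain ⟨w', rfl⟩ : ∃ w' : Fin (ρ.eval y.length) → Bool, List.ofFn w' = w := by
      rw [← hw]
      exact ⟨w.get, List.ofFn_get w⟩
    exact hP y hy w'
  have hgood : ∀ x, N₀ ≤ x.length → e x ∈ yes ∪ no := fun x hx => by
    by_cases hxL : x ∈ L
    · exact Or.inl (hyes x hxL hx)
    · exact Or.inr (hno x hxL hx)
  have hoP : PolyTime (fun b : {b : List Bool × List Bool // b.1 ∈ yes ∪ no ∧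
      b.2.length = ρ.eval b.1.length} => [b.1.1, b.1.2]) (fun b => o b.1.1 b.1.2) := by
    refine ⟨P, τ, fun ⟨b, hb, hw⟩ => ?_⟩
    obtain ⟨t, s, hex, ht⟩ := hhalt b.1 hb b.2 hw
    exact ⟨t, s, hex, (ho hex).symm, ht.trans (eval_mono τ (by simp [inputSize]))⟩
  let α := {a : List Bool × List Bool // a.2.length = ρ'.eval a.1.length}
  let inp : α → List (List Bool) := fun a => [a.1.1, a.1.2]
  have hn : ∀ a, (inp a).length = 2 := fun _ => rfl
  have hx : Clean 2 inp (fun a => a.1.1) := Clean.var hn 0 (by omega)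
  have hw : Clean 2 inp (fun a => a.1.2) := Clean.var hn 1 (by omega)
  -- Short instances may violate the promise after the reduction, so they are decided by lookup and
  -- the distinguisher is never run on them.
  let out : α → List Bool := fun a => if ¬ N₀ ≤ a.1.1.length then
    [decide (a.1.1.length < N₀ ∧ a.1.1 ∈ L)] else o (e a.1.1) a.1.2
  have hout : Clean 2 inp out := by
    refine Clean.ite_of_decides ((Computes.const hn N₀).decides_le hx.length).not
      ((hx.decides_short N₀ L).bit.comap Subtype.val) ?_
    refine Clean.comp (fun _ => rfl) [fun a => e a.1.1.1, fun a => a.1.1.2] ?_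
      (hoP.comap fun a : {a : α // ¬ ¬ N₀ ≤ a.1.1.length} =>
        ⟨(e a.1.1.1, a.1.1.2), hgood _ (not_not.1 a.2), a.1.2.trans (hρ _)⟩)
    have h1 := (Clean.comp₁ he.polyTime hx).comap
      (Subtype.val : {a : α // ¬ ¬ N₀ ≤ a.1.1.length} → α)
    have h2 := hw.comap (Subtype.val : {a : α // ¬ ¬ N₀ ≤ a.1.1.length} → α)
    simp [h1, h2]
  obtain ⟨P', τ', hP'⟩ := hout.polyTime
  have hacc : ∀ x w (hxw : w.length = ρ'.eval x.length),
      (Accepts P' x w ↔ out ⟨(x, w), hxw⟩ = [true]) := by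
    intro x w hxw
    obtain ⟨t, s, hex, hs, -⟩ := hP' ⟨(x, w), hxw⟩
    rw [accepts_iff hex, hs]
  have hlong : ∀ x, N₀ ≤ x.length → ∀ w : List Bool, w.length = ρ'.eval x.length →
      (Accepts P' x w ↔ Accepts P (e x) w) := by
    intro x hxN w hxw
    obtain ⟨t, s, hex, -⟩ := hhalt (e x) (hgood x hxN) w (hxw.trans (hρ x))
    rw [hacc x w hxw, accepts_iff hex]
    simp only [out, hxN, not_true_eq_false, if_false, ho hex]
  have hshort : ∀ x, ¬ N₀ ≤ x.length → ∀ w : List Bool, w.length = ρ'.eval x.length →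
      (Accepts P' x w ↔ x ∈ L) := by
    intro x hxN w hxw
    rw [hacc x w hxw]
    have : x.length < N₀ := not_le.1 hxN
    simp [out, this]
  refine ⟨P', ρ', τ'.comp (Polynomial.X + ρ'), fun x _ w => ?_, fun x hxL => ?_, fun x hxL => ?_⟩
  · obtain ⟨t, s, hex, -, ht⟩ := hP' ⟨(x, List.ofFn w), by simp⟩
    refine ⟨t, s, hex, ht.trans (le_of_eq ?_)⟩
    simp [inp, inputSize]
  · by_cases hxN : N₀ ≤ x.length
    · rw [acceptProb_congr (hρ x) (hlong x hxN)]
      exact hPyes _ (hyes x hxL hxN)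
    · rw [acceptProb_of_forall fun w hw' => (hshort x hxN w hw').2 hxL]
      norm_num
  · by_cases hxN : N₀ ≤ x.length
    · rw [acceptProb_congr (hρ x) (hlong x hxN)]
      exact hPno _ (hno x hxL hxN)
    · rw [acceptProb_of_forall_not fun w hw' hA => hxL ((hshort x hxN w hw').1 hA)]
      norm_num

/-! ## Parameters -/

/-- With error N^(-c) the size bound of the conjecture is (N + N^c)^d + d. The base N + 2 is at
least 2, so extra powers of it absorb the doubling and the additive d. -/
theorem add_rpow_pow_add_le (c : ℝ) (d N : ℕ) (hN : 1 ≤ N) :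
    ((N : ℝ) + (N : ℝ) ^ c) ^ d + d ≤ ((N : ℝ) + 2) ^ ((⌈c⌉₊ + 2) * d + d) := by
  have hN' : (1 : ℝ) ≤ N := by exact_mod_cast hN
  have h1 : (N : ℝ) ^ c ≤ (N : ℝ) ^ ⌈c⌉₊ := by
    rw [← Real.rpow_natCast]
    exact Real.rpow_le_rpow_of_exponent_le hN' (Nat.le_ceil c)
  have h2 : (N : ℝ) ^ ⌈c⌉₊ ≤ ((N : ℝ) + 2) ^ (⌈c⌉₊ + 1) :=
    (pow_le_pow_left₀ (by positivity) (by linarith) _).trans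
      (pow_le_pow_right₀ (by linarith) (Nat.le_succ _))
  have h3 : (N : ℝ) ≤ ((N : ℝ) + 2) ^ (⌈c⌉₊ + 1) :=
    (show (N : ℝ) ≤ N + 2 by linarith).trans (le_self_pow₀ (by linarith) (Nat.succ_ne_zero _))
  have h4 : (N : ℝ) + (N : ℝ) ^ c ≤ ((N : ℝ) + 2) ^ (⌈c⌉₊ + 2) := by
    calc _ ≤ 2 * ((N : ℝ) + 2) ^ (⌈c⌉₊ + 1) := by linarith
      _ ≤ ((N : ℝ) + 2) * ((N : ℝ) + 2) ^ (⌈c⌉₊ + 1) := by gcongr; linarith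
      _ = _ := by ring
  have h5 : ((N : ℝ) + (N : ℝ) ^ c) ^ d ≤ ((N : ℝ) + 2) ^ ((⌈c⌉₊ + 2) * d) := by
    rw [pow_mul]
    exact pow_le_pow_left₀ (by positivity) h4 d
  have h6 : (1 : ℝ) + d ≤ ((N : ℝ) + 2) ^ d := by
    have := one_add_mul_le_pow (a := (N : ℝ) + 1) (by linarith) d
    have h7 : (d : ℝ) * 1 ≤ d * ((N : ℝ) + 1) :=
      mul_le_mul_of_nonneg_left (by linarith) (by positivity)
    rw [show (N : ℝ) + 2 = 1 + (N + 1) by ring]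
    linarith
  have h7 : (1 : ℝ) ≤ ((N : ℝ) + 2) ^ ((⌈c⌉₊ + 2) * d) := one_le_pow₀ (by linarith)
  rw [pow_add]
  nlinarith [mul_le_mul_of_nonneg_left h6 (zero_le_one.trans h7),
    mul_le_mul_of_nonneg_right h7 (Nat.cast_nonneg (α := ℝ) d)]

/-- For N ≥ 1, N + 2 ≤ 3N, so the left side is a constant times N^(c/2). The factor 9 is the square
of the 3 in K = 3s in the final estimate. -/
theorem exists_forall_rpow_lt {c : ℝ} (hc : 0 < c) :
    ∃ N₀ : ℕ, ∀ N : ℕ, N₀ ≤ N → 9 * ((N : ℝ) + 2) ^ (c / 2) < (N : ℝ) ^ c := by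
  have ht : Filter.Tendsto (fun N : ℕ => (N : ℝ) ^ (c / 2)) Filter.atTop Filter.atTop :=
    (tendsto_rpow_atTop (by positivity)).comp tendsto_natCast_atTop_atTop
  obtain ⟨N₀, hN₀⟩ := Filter.eventually_atTop.1 (ht.eventually_gt_atTop (9 * (3 : ℝ) ^ (c / 2)))
  refine ⟨max N₀ 1, fun N hN => ?_⟩
  have h1 := hN₀ N (le_of_max_le_left hN)
  have hN1 : (1 : ℝ) ≤ N := by exact_mod_cast le_of_max_le_right hN
  have hpos : (0 : ℝ) < (N : ℝ) ^ (c / 2) := Real.rpow_pos_of_pos (by linarith) _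
  calc 9 * ((N : ℝ) + 2) ^ (c / 2) ≤ 9 * (3 * (N : ℝ)) ^ (c / 2) := by
        gcongr
        linarith
    _ = 9 * (3 : ℝ) ^ (c / 2) * (N : ℝ) ^ (c / 2) := by
        rw [Real.mul_rpow (by norm_num) (by linarith)]; ring
    _ < (N : ℝ) ^ (c / 2) * (N : ℝ) ^ (c / 2) := by gcongr
    _ = (N : ℝ) ^ c := by rw [← Real.rpow_add (by linarith)]; ring_nf

theorem polyGrowth_rpow {c : ℝ} (hc : 0 < c) : PolyGrowth fun p => (p : ℝ) ^ c :=
  ⟨c, hc, Filter.Eventually.of_forall fun _ => le_rfl⟩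

/-- A verifier for SAT with polynomially small error and sets of size polynomial in `N`. -/
theorem BiregularPGC.exists_verifier (h : BiregularPGC) :
    ∃ (c : ℝ) (g : ℕ) (V : Verifier), 0 < c ∧ 0 < g ∧ V.Efficient ∧ V.PerfectCompleteness SAT ∧
      V.Functionality ∧ V.Uniformity ∧
      (∀ x ∉ SAT, 1 ≤ x.length → ∀ P₁ P₂, V.value x P₁ P₂ ≤ 1 / (x.length : ℝ) ^ c) ∧
      ∀ x, V.nR x ≤ (x.length + 2) ^ g ∧ V.nQ₁ x ≤ (x.length + 2) ^ g ∧
        V.nQ₂ x ≤ (x.length + 2) ^ g ∧ V.nA₁ x + V.nA₂ x ≤ (x.length + 2) ^ g := by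
  obtain ⟨c, hc, d, h⟩ := h
  -- The maximum only matters at N = 0, where 1/0^c would evaluate to 0 and violate positivity.
  let ε : ℕ → ℝ := fun N => 1 / ((max N 1 : ℕ) : ℝ) ^ c
  have hmax : ∀ N : ℕ, (1 : ℝ) ≤ (max N 1 : ℕ) := fun N => by exact_mod_cast le_max_right _ _
  obtain ⟨V, hE, hC, hS, hB, hF, hU⟩ := h ε fun N => by
    have hpos : (0 : ℝ) < ((max N 1 : ℕ) : ℝ) ^ c := Real.rpow_pos_of_pos (by linarith [hmax N]) _
    refine ⟨by positivity, ?_⟩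
    rcases Nat.eq_zero_or_pos N with rfl | hN
    · simp [ε, Real.zero_rpow hc.ne']
    · simp only [ε, max_eq_left (Nat.succ_le_of_lt hN)]
      exact le_rfl
  set f := (⌈c⌉₊ + 2) * d + d with hf
  -- The doubled exponent absorbs max(N, 1) + 2 ≤ (N + 2)², and the last factor leaves room for the
  -- sum |A₁| + |A₂|.
  refine ⟨c, 2 * f + 1, V, hc, by omega, hE, hC, hF, hU, fun x hx hx1 P₁ P₂ => ?_, fun x => ?_⟩
  · have := hS x hx P₁ P₂
    simpa only [ε, max_eq_left hx1] using this
  · have hb : ((x.length : ℝ) + 1 / ε x.length) ^ d + d ≤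
        (((max x.length 1 : ℕ) : ℝ) + 2) ^ f := by
      refine le_trans ?_ (add_rpow_pow_add_le c d _ (le_max_right _ _))
      have h1 : (0 : ℝ) < ((max x.length 1 : ℕ) : ℝ) ^ c :=
        Real.rpow_pos_of_pos (by linarith [hmax x.length]) _
      simp only [ε, one_div_one_div]
      gcongr
      exact le_max_left _ _
    have hb' : (((max x.length 1 : ℕ) : ℝ) + 2) ^ f ≤ ((x.length + 2) ^ (2 * f) : ℕ) := by
      have h3 : max x.length 1 + 2 ≤ (x.length + 2) ^ 2 := by
        have : max x.length 1 ≤ x.length + 1 := by omega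
        nlinarith
      calc (((max x.length 1 : ℕ) : ℝ) + 2) ^ f = ((max x.length 1 + 2) ^ f : ℕ) := by push_cast; rfl
        _ ≤ (((x.length + 2) ^ 2) ^ f : ℕ) := by exact_mod_cast Nat.pow_le_pow_left h3 f
        _ = _ := by rw [pow_mul]
    have key : ∀ k : ℕ, (k : ℝ) ≤ ((x.length : ℝ) + 1 / ε x.length) ^ d + d →
        k ≤ (x.length + 2) ^ (2 * f) := fun k hk => by
      exact_mod_cast hk.trans (hb.trans hb')
    obtain ⟨k1, k2, k3, k4, k5⟩ := hB x
    have k1 := key _ k1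
    have k2 := key _ k2
    have k3 := key _ k3
    have k4 := key _ k4
    have k5 := key _ k5
    have hstep : 2 * (x.length + 2) ^ (2 * f) ≤ (x.length + 2) ^ (2 * f + 1) := by
      rw [pow_succ, Nat.mul_comm]
      exact Nat.mul_le_mul_left _ (by omega)
    refine ⟨?_, ?_, ?_, ?_⟩ <;> omega

end SparseReg

/-! ### Choice of parameters and the reduction from SAT -/

open SparseReg in
theorem mainTheorem9 (hPGC : SparseReg.BiregularPGC) :
    ∃ σ Δ : ℕ → ℝ, SparseReg.PolyGrowth σ ∧ SparseReg.PolyGrowth Δ ∧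
      (SparseReg.SAT ∉ SparseReg.BPP →
        ∃ (m : Polynomial ℕ) (k : ℕ → ℕ),
          (∀ p, 0 < k p) ∧
          SparseReg.PolyTime (fun p : ℕ => [SparseReg.unary p])
            (fun p => SparseReg.unary (k p)) ∧
          ∀ p₀ : ℕ, ¬ SparseReg.BPPDistinguishable
            (SparseReg.sparseCase m k p₀) (SparseReg.denseCase m k σ Δ p₀)) := by
  obtain ⟨c, g, V, hc, hg, hE, hC, hF, hU, hS, hsize⟩ := hPGC.exists_verifier
  have hg' : (0 : ℝ) < g := by exact_mod_cast hg
  -- On the reduction's matrices p = (N + 2)^(2g), so σ² = (N + 2)^(c/2): half of the soundness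
  -- exponent is spent, and the other half beats the constants.
  refine ⟨fun p => (p : ℝ) ^ (c / (8 * g)), fun p => (p : ℝ) ^ (1 : ℝ),
    polyGrowth_rpow (by positivity), polyGrowth_rpow one_pos, fun hSAT => ?_⟩
  -- The square root recovers H from p. The summand 1 serves only to keep k positive at p = 0.
  refine ⟨Polynomial.X ^ 5, fun p => 2 * Nat.sqrt p + 1, fun _ => Nat.succ_pos _, ?_,
    fun p₀ hdist => hSAT ?_⟩
  · have hn : ∀ p : ℕ, [unary p].length = 1 := fun _ => rfl
    have hp : Computes 1 (fun p : ℕ => [unary p]) (fun p => p) := Clean.var hn 0 one_pos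
    exact (((Computes.const hn 2).mul hp.sqrt).add (Computes.const hn 1)).polyTime
  let H : List Bool → ℕ := fun x => (x.length + 2) ^ g
  let p : List Bool → ℕ := fun x => H x ^ 2
  obtain ⟨N₁, hN₁⟩ := exists_forall_rpow_lt hc
  have hsqrt : ∀ x, Nat.sqrt (p x) = H x := fun x => Nat.sqrt_eq' _
  have hHpos : ∀ x, 0 < H x := fun x => pow_pos (by omega) _
  have hn : ∀ x : List Bool, [x].length = 1 := fun _ => rfl
  have hX : Clean 1 (fun x : List Bool => [x]) (fun x => x) := Clean.var hn 0 one_pos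
  have hH : Computes 1 (fun x : List Bool => [x]) H := by
    convert Computes.polynomial (Clean.length hX) ((Polynomial.X + 2) ^ g) using 3 with x
    simp [H]
  have hp : Computes 1 (fun x : List Bool => [x]) p := by
    convert hH.polynomial (Polynomial.X ^ 2) using 3 with x
    simp [p]
  have hm : Computes 1 (fun x : List Bool => [x])
      (fun x => (Polynomial.X ^ 5 : Polynomial ℕ).eval (p x)) := hp.polynomial _
  have hpA : ∀ x, H x * V.nA₁ x + H x * V.nA₂ x ≤ p x := fun x => by
    rw [← Nat.mul_add]
    exact (Nat.mul_le_mul_left _ (hsize x).2.2.2).trans_eq (sq _).symm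
  have hp₀ : ∀ x : List Bool, x.length ≤ p x := fun x => by
    have h1 : x.length + 2 ≤ H x := Nat.le_self_pow hg.ne' _
    have h2 : H x ≤ p x := Nat.le_self_pow two_ne_zero _
    omega
  refine hdist.of_reduction (hE.clean_encodeMatrix hX hH hHpos hm hp)
    ((((Polynomial.X + 2) ^ g) ^ 2) ^ 5 + 1 +
      ((Polynomial.X + 2) ^ g) ^ 2 + 1 + (((Polynomial.X + 2) ^ g) ^ 2) ^ 5 *
      ((Polynomial.X + 2) ^ g) ^ 2) (fun x => ?_) (max p₀ (max N₁ 1)) (fun x hx hN => ?_)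
    fun x hx hN => ?_
  · rw [length_encodeMatrix]
    simp [p, H]
  · simp only [max_le_iff] at hN
    obtain ⟨P₁, P₂, hv⟩ := hC x hx
    obtain ⟨y, hy, hBy, hk⟩ := Verifier.hasExactSparse_matrix hF (hHpos x) (hpA x) hv
      (m := (Polynomial.X ^ 5 : Polynomial ℕ).eval (p x))
    refine ⟨p x, _, hN.1.trans (hp₀ x), rfl, y, hy, hBy, ?_⟩
    beta_reduce
    rw [hsqrt]
    omega
  · simp only [max_le_iff] at hN
    refine ⟨p x, _, hN.1.trans (hp₀ x), rfl, fun y hy => ?_⟩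
    by_contra hlt
    push Not at hlt
    rw [hsqrt] at hlt
    set s : ℝ := ((p x : ℕ) : ℝ) ^ (c / (8 * g)) with hs
    have hbase : (0 : ℝ) < (x.length : ℝ) + 2 := by positivity
    have hs2 : s ^ 2 = ((x.length : ℝ) + 2) ^ (c / 2) := by
      have : ((p x : ℕ) : ℝ) = ((x.length : ℝ) + 2) ^ ((2 * g : ℕ) : ℝ) := by
        rw [Real.rpow_natCast]
        simp only [p, H]
        push_cast
        rw [← pow_mul, Nat.mul_comm]
      rw [hs, this, ← Real.rpow_mul hbase.le, ← Real.rpow_natCast, ← Real.rpow_mul hbase.le]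
      congr 1
      push_cast
      field_simp
      norm_num
    have hspos : 0 < s := Real.rpow_pos_of_pos (by exact_mod_cast pow_pos (hHpos x) 2) _
    have hH1 : (1 : ℝ) ≤ H x := by exact_mod_cast hHpos x
    -- K = 3s since k·σ = (2H + 1)s ≤ 3Hs. The resulting value is at least 1/(9(N + 2)^(c/2)),
    -- against a soundness error of at most 1/N^c.
    obtain ⟨P₁, P₂, hv⟩ := Verifier.exists_value_ge_of_approx hU (hsize x).1 (hsize x).2.1
      (hsize x).2.2.1 (hsize x).2.2.2 (H := H x) (p := p x)
      (by simp) rfl y (hy.trans_eq (Real.rpow_one _)) (K := 3 * s)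
      (by positivity) (by
        refine hlt.le.trans ?_
        push_cast
        have : (2 * (H x : ℝ) + 1) * s ≤ 3 * H x * s :=
          mul_le_mul_of_nonneg_right (by linarith) hspos.le
        linarith)
    have h1 := hv.trans (hS x hx hN.2.2 P₁ P₂)
    have h2 := hN₁ x.length hN.2.1
    have h3 : (3 * s) ^ 2 = 9 * ((x.length : ℝ) + 2) ^ (c / 2) := by rw [mul_pow, hs2]; norm_num
    rw [h3] at h1
    have h4 : (0 : ℝ) < 9 * ((x.length : ℝ) + 2) ^ (c / 2) := by positivity
    exact absurd h1 (not_le.2 (one_div_lt_one_div_of_lt h4 h2))
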